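/- Let $G=(U,V,E)$ be a finite bipartite graph with at least one edge, given by the list of the vertices of $U$ and by a list of neighbours for each vertex. Write $\nu=|U|$, $m=|E|$, and $N(x)$ for the set of neighbours of a vertex $x$. For $u\in U$ let $N_2(u)=\bigcup_{v\in N(u)}N(v)\setminus\{u\}$ and $N^P(u)=N(u)\cup N_2(u)$. The bidegeneracy $b(u)$ of $u\in U$ is the maximum $b$ for which there is $U'\subseteq U$ with $u\in U'$ and $|N^P(x)\cap(U'\cup V)|\ge b$ for all $x\in U'$, and $b_U=\max_{u\in U}b(u)$. A bidegeneracy order of $U$ is an enumeration $u_1,\dots,u_\nu$ of $U$ such that, for every $i$, $u_i$ minimizes $|N^P(u)\setminus\{u_1,\dots,u_{i-1}\}|$ over $u\in\{u_i,\dots,u_\nu\}$. Algorithm BBK computes a bidegeneracy order $u_1,\dots,u_\nu$ of $U$ and then, for $i=1,\dots,\nu$, calls $$\mathrm{BK}\bigl(\{u_i\},\ N^P(u_i)\setminus\{u_1,\dots,u_{i-1}\},\ N^P(u_i)\cap\{u_1,\dots,u_{i-1}\}\bigr),$$ where $\mathrm{BK}(R,P,X)$ is the following recursive procedure; $S_U=S\cap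 U$ and $S_V=S\cap V$ for a set $S$ of vertices. 1. If ($P_U=\emptyset$ or $P_V=\emptyset$) and $X=\emptyset$, output $R\cup P$ and return. 2. If ($P_U=\emptyset$ and $X_V\ne\emptyset$) or ($P_V=\emptyset$ and $X_U\neq\emptyset$), return. 3. For $p\in P\cup X$ let $Q(p)=(P_V\setminus N(p))\cup(\{p\}\cap P)$ if $p\in U$, and $Q(p)=(P_U\setminus N(p))\cup(\{p\}\cap P)$ if $p\in V$. Choose a pivot $p\in P\cup X$ that minimizes $|Q(p)|$. 4. For each $x\in Q(p)$ in turn: call $\mathrm{BK}(R\cup\{x\},P_x,X_x)$ and then replace $P$ by $P\setminus\{x\}$ and $X$ by $X\cup\{x\}$. Here, with the current $P$ and $X$, $P_x=(P_U\setminus\{x\})\cup(P_V\cap N(x))$ and $X_x=X_U\cup(X_V\cap N(x))$ if $x\in U$, and $P_x=(P_V\setminus\{x\})\cup(P_U\cap N(x))$ and $X_x=X_V\cup(X_U\cap N(x))$ if $x\in V$. Then Algorithm BBK runs in time $$O\bigl((\nu+m)\cdot b_U\cdot 3^{b_U/3}\bigr).$$ That is, there are a constant $C$, independent of the graph, and an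 explicit implementation of BBK with linked lists and arrays, every elementary operation (comparison or arithmetic operation on vertex names and integers, access to a list cell or to an array cell) counting as one step, which on every such input carries out an execution of BBK, including the computation of the bidegeneracy order and the writing of the output, in at most $C\,(\nu+m)\,b_U\,3^{b_U/3}$ steps. -/

import Mathlib

/-!
Bipartite graphs `G = (U, V, E)` are given by finite types `U`, `V` and a finite set
`E : Finset (U × V)` of edges; a vertex is an element of `U ⊕ V`.

Part 1 has the graph notions.  Part 2 is the pseudocode of the algorithm, as a (nondeterministic)
transition relation on finite sets of vertices.  Part 3 is an implementation on linked lists and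
arrays with a step count.
-/

namespace BBK

/-! ### Part 1: neighbourhoods, bidegeneracy order, bidegeneracy -/

section Graph

variable {U V : Type} [Fintype U] [Fintype V] [DecidableEq U] [DecidableEq V]

/-- The neighbourhood `N(x)`. -/
def nbr (E : Finset (U × V)) : U ⊕ V → Finset (U ⊕ V)
  | .inl u => (Finset.univ.filter fun v : V => (u, v) ∈ E).image Sum.inr
  | .inr v => (Finset.univ.filter fun u : U => (u, v) ∈ E).image Sum.inl

/-- `N₂(u)`: the neighbours of the neighbours of `u`, without `u` itself. -/
def nbr2 (E : Finset (U × V)) (u : U) : Finset (U ⊕ V) :=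
  ((nbr E (.inl u)).biUnion (nbr E)).erase (.inl u)

/-- The projection-extended neighbourhood `Nᴾ(u) = N(u) ∪ N₂(u)` of `u ∈ U`. -/
def projNbr (E : Finset (U × V)) (u : U) : Finset (U ⊕ V) :=
  nbr E (.inl u) ∪ nbr2 E u

/-- A set of vertices of `U`, as a set of vertices of the graph. -/
def ofU (S : Finset U) : Finset (U ⊕ V) := S.image Sum.inl

/-- The whole vertex class `V`, as a set of vertices of the graph. -/
def allV : Finset (U ⊕ V) := Finset.univ.image Sum.inr

/-- The list `us = u₁, …, uₙ` is a bidegeneracy order of `U`: it lists every vertex of `U` exactly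
once, and whenever `us = prev ++ u :: rest`, the vertex `u` minimizes `|Nᴾ(w) \ prev|` among the
vertices `w` of `u :: rest`. -/
def IsBidegeneracyOrder (E : Finset (U × V)) (us : List U) : Prop :=
  us.Nodup ∧ (∀ u, u ∈ us) ∧
    ∀ (prev rest : List U) (u : U), us = prev ++ u :: rest → ∀ w ∈ u :: rest,
      (projNbr E u \ ofU prev.toFinset).card ≤ (projNbr E w \ ofU prev.toFinset).card

/-- The bidegeneracy `b(u)` of `u ∈ U`: the maximum `b` such that some `U' ⊆ U` with `u ∈ U'`
satisfies `|Nᴾ(x) ∩ (U' ∪ V)| ≥ b` for all `x ∈ U'`. (Taking `x = u` shows that these `b` are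
bounded.) -/
noncomputable def bideg (E : Finset (U × V)) (u : U) : ℕ :=
  sSup {b : ℕ | ∃ U' : Finset U, u ∈ U' ∧ ∀ x ∈ U', b ≤ (projNbr E x ∩ (ofU U' ∪ allV)).card}

/-- The bidegeneracy `b_U` of `U`: the maximum of `b(u)` over `u ∈ U`. -/
noncomputable def bidegU (E : Finset (U × V)) : ℕ :=
  Finset.univ.sup (bideg E)

end Graph

/-! ### Part 2: the pseudocode -/

section Pseudocode

variable {U V : Type} [Fintype U] [Fintype V] [DecidableEq U] [DecidableEq V]

/-- `P_U`. -/
def uPart (P : Finset (U ⊕ V)) : Finset (U ⊕ V) := P.filter fun x => x.isLeft = true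

/-- `P_V`. -/
def vPart (P : Finset (U ⊕ V)) : Finset (U ⊕ V) := P.filter fun x => x.isRight = true

/-- The set `Q` of branching vertices for the pivot `p`. -/
def branchSet (E : Finset (U × V)) (P : Finset (U ⊕ V)) (p : U ⊕ V) : Finset (U ⊕ V) :=
  (if p ∈ P then {p} else ∅) ∪
    (if p.isLeft then vPart P \ nbr E p else uPart P \ nbr E p)

/-- The set `P_x`. -/
def childP (E : Finset (U × V)) (P : Finset (U ⊕ V)) (x : U ⊕ V) : Finset (U ⊕ V) :=
  if x.isLeft then (uPart P).erase x ∪ (vPart P ∩ nbr E x)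
  else (vPart P).erase x ∪ (uPart P ∩ nbr E x)

/-- The set `X_x`. -/
def childX (E : Finset (U × V)) (X : Finset (U ⊕ V)) (x : U ⊕ V) : Finset (U ⊕ V) :=
  if x.isLeft then uPart X ∪ (vPart X ∩ nbr E x)
  else vPart X ∪ (uPart X ∩ nbr E x)

/-- The test for reporting `R ∪ P`. -/
def ReportTest (P X : Finset (U ⊕ V)) : Prop :=
  (uPart P = ∅ ∨ vPart P = ∅) ∧ X = ∅

/-- The test for giving up. -/
def StopTest (P X : Finset (U ⊕ V)) : Prop :=
  (uPart P = ∅ ∧ vPart X ≠ ∅) ∨ (vPart P = ∅ ∧ uPart X ≠ ∅)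

mutual

/-- `Call E R P X out out'`: the recursive function, called on `R`, `P`, `X` when the output so far
is `out`, can return with output `out'`. Outputs are listed with the most recent one first. The
pivot is any `p ∈ P ∪ X` that minimizes the size of `Q`, and `Q` is traversed in any order. -/
inductive Call (E : Finset (U × V)) :
    Finset (U ⊕ V) → Finset (U ⊕ V) → Finset (U ⊕ V) →
      List (Finset (U ⊕ V)) → List (Finset (U ⊕ V)) → Prop
  | report (R P X : Finset (U ⊕ V)) (out : List (Finset (U ⊕ V))) :
      ReportTest P X → Call E R P X out ((R ∪ P) :: out)
  | giveUp (R P X : Finset (U ⊕ V)) (out : List (Finset (U ⊕ V))) :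
      ¬ ReportTest P X → StopTest P X → Call E R P X out out
  | branch (R P X : Finset (U ⊕ V)) (out out' : List (Finset (U ⊕ V)))
      (p : U ⊕ V) (qs : List (U ⊕ V)) :
      ¬ ReportTest P X → ¬ StopTest P X →
      p ∈ P ∪ X → (∀ p' ∈ P ∪ X, (branchSet E P p).card ≤ (branchSet E P p').card) →
      qs.Nodup → qs.toFinset = branchSet E P p →
      Loop E R P X qs out out' → Call E R P X out out'

/-- `Loop E R P X qs out out'`: the `for` loop inside the recursive function, with the vertices `qs`
still to be treated, and with `P` and `X` the current values of these variables. -/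
inductive Loop (E : Finset (U × V)) :
    Finset (U ⊕ V) → Finset (U ⊕ V) → Finset (U ⊕ V) → List (U ⊕ V) →
      List (Finset (U ⊕ V)) → List (Finset (U ⊕ V)) → Prop
  | nil (R P X : Finset (U ⊕ V)) (out : List (Finset (U ⊕ V))) : Loop E R P X [] out out
  | cons (R P X : Finset (U ⊕ V)) (x : U ⊕ V) (qs : List (U ⊕ V))
      (out out₁ out₂ : List (Finset (U ⊕ V))) :
      Call E (R ∪ {x}) (childP E P x) (childX E X x) out out₁ →
      Loop E R (P \ {x}) (X ∪ {x}) qs out₁ out₂ →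
      Loop E R P X (x :: qs) out out₂

end

/-- The outer loop, with `prev` the vertices of `U` already treated, in the remaining order `us`. -/
inductive Outer (E : Finset (U × V)) :
    Finset U → List U → List (Finset (U ⊕ V)) → List (Finset (U ⊕ V)) → Prop
  | nil (prev : Finset U) (out : List (Finset (U ⊕ V))) : Outer E prev [] out out
  | cons (prev : Finset U) (u : U) (us : List U) (out out₁ out₂ : List (Finset (U ⊕ V))) :
      Call E {.inl u} (projNbr E u \ ofU prev) (projNbr E u ∩ ofU prev) out out₁ →
      Outer E (insert u prev) us out₁ out₂ →
      Outer E prev (u :: us) out out₂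

/-- `out` is the output (most recent first) of an execution of the algorithm. -/
def IsRun (E : Finset (U × V)) (out : List (Finset (U ⊕ V))) : Prop :=
  ∃ us : List U, IsBidegeneracyOrder E us ∧ Outer E ∅ us [] out

end Pseudocode

/-! ### Part 3: implementation with a step count -/

/-- The input representation: a list of the vertices of `U`, and for each vertex of the graph an
(arbitrarily ordered) list of its neighbours. -/
structure AdjLists {U V : Type} (E : Finset (U × V)) where
  verts : List U
  nbrU : U → List V
  nbrV : V → List U
  verts_nodup : verts.Nodup
  mem_verts : ∀ u, u ∈ verts
  nbrU_nodup : ∀ u, (nbrU u).Nodup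
  nbrV_nodup : ∀ v, (nbrV v).Nodup
  mem_nbrU : ∀ u v, v ∈ nbrU u ↔ (u, v) ∈ E
  mem_nbrV : ∀ u v, u ∈ nbrV v ↔ (u, v) ∈ E

/-- A computation with its number of steps. The steps are those of a random access machine: every
elementary operation is written `op _` and costs one step. Elementary operations are a bounded
number of comparisons, additions and subtractions of vertex names or of integers, the inspection or
construction of one list cell or record, and one access to an array. Every equation of every
function below performs an operation, so that function calls and the traversal of lists are paid
for. Lists are linked lists. An array is a Lean function that is read by application and written by
`Function.update`; an array that has been written is never used in its former state. -/
structure Timed (α : Type) where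
  val : α
  time : ℕ

instance : Monad Timed where
  pure a := ⟨a, 0⟩
  bind x f := ⟨(f x.val).val, x.time + (f x.val).time⟩

/-- An elementary operation with result `a`: one step. -/
def op {α : Type} (a : α) : Timed α := ⟨a, 1⟩

/-- Allocation of an array of `n` cells, all initialized to `a`: `n + 1` steps. -/
def alloc {ι α : Type} (n : ℕ) (a : α) : Timed (ι → α) := ⟨fun _ => a, n + 1⟩

section Lists

variable {α β : Type}

def lengthT : List α → Timed ℕ
  | [] => op 0
  | _ :: l => do
    let n ← lengthT l
    op (n + 1)

def appendT : List α → List α → Timed (List α)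
  | [], k => op k
  | a :: l, k => do
    let r ← appendT l k
    op (a :: r)

def mapT (f : α → Timed β) : List α → Timed (List β)
  | [] => op []
  | a :: l => do
    let b ← f a
    let r ← mapT f l
    op (b :: r)

def filterT (q : α → Timed Bool) : List α → Timed (List α)
  | [] => op []
  | a :: l => do
    let b ← q a
    let r ← filterT q l
    if b then op (a :: r) else op r

variable [DecidableEq α] [DecidableEq β]

def memT (a : α) : List α → Timed Bool
  | [] => op false
  | b :: l => do
    let c ← op (decide (a = b))
    if c then op true else memT a l

/-- The elements of `l` that lie in `k`. -/
def interT (k l : List α) : Timed (List α) := filterT (fun a => memT a k) l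

/-- `l` without the element `x`. -/
def eraseT (x : α) (l : List α) : Timed (List α) := filterT (fun a => op (decide (a ≠ x))) l

/-! In the recursive function, every vertex `w` of `P ∪ X` is stored together with the list of its
neighbours in `P`, as an entry `(w, N(w) ∩ P)`. -/

/-- The neighbour list stored with the vertex `x`. -/
def lookupT (x : α) : List (α × List β) → Timed (List β)
  | [] => op []
  | e :: es => do
    let c ← op (decide (e.1 = x))
    if c then op e.2 else lookupT x es

/-- Remove the entry of the vertex `x`. -/
def dropT (x : α) (es : List (α × List β)) : Timed (List (α × List β)) :=
  filterT (fun e => op (decide (e.1 ≠ x))) es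

/-- Intersect all stored neighbour lists with `k`. -/
def restrictT (k : List β) (es : List (α × List β)) : Timed (List (α × List β)) :=
  mapT (fun e => do
    let l ← interT k e.2
    op (e.1, l)) es

/-- Remove `x` from all stored neighbour lists. -/
def eraseNbrT (x : β) (es : List (α × List β)) : Timed (List (α × List β)) :=
  mapT (fun e => do
    let l ← eraseT x e.2
    op (e.1, l)) es

/-- Keep the entries of the neighbours of `x ∈ P`, and remove `x` from their neighbour lists. -/
def keepT (x : β) (es : List (α × List β)) : Timed (List (α × List β)) := do
  let es' ← filterT (fun e => memT x e.2) es
  eraseNbrT x es'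

end Lists

/-- The sets `P_U`, `P_V`, `X_U`, `X_V`, as lists of entries. -/
structure Sets (U V : Type) where
  pu : List (U × List V)
  pv : List (V × List U)
  xu : List (U × List V)
  xv : List (V × List U)

/-- Exchange the roles of `U` and `V`. -/
def Sets.swap {U V : Type} (S : Sets U V) : Sets V U := ⟨S.pv, S.pu, S.xv, S.xu⟩

/-- A pivot, with the information whether it lies in `P`, and with its list of neighbours in `P`. -/
inductive Pivot (U V : Type) where
  | left (inP : Bool) (u : U) (l : List V)
  | right (inP : Bool) (v : V) (l : List U)

section Recursion

variable {U V : Type} [DecidableEq U] [DecidableEq V]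

/-- The sets `P_x`, `X_x` for a vertex `x ∈ P` of the first side with neighbours `nx` in `P`. -/
def childT (x : U) (nx : List V) (S : Sets U V) : Timed (Sets U V) := do
  let pu₁ ← dropT x S.pu
  let pu ← restrictT nx pu₁
  let pv ← keepT x S.pv
  let xu ← restrictT nx S.xu
  let xv ← keepT x S.xv
  op ⟨pu, pv, xu, xv⟩

/-- The assignments `P ← P \ {x}` and `X ← X ∪ {x}`. -/
def moveT (x : U) (nx : List V) (S : Sets U V) : Timed (Sets U V) := do
  let pu ← dropT x S.pu
  let pv ← eraseNbrT x S.pv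
  let xv ← eraseNbrT x S.xv
  op ⟨pu, pv, (x, nx) :: S.xu, xv⟩

/-- Scan a list of entries for a pivot candidate with `base - |N(w) ∩ P|` as small as possible. -/
def scanT {α β : Type} (mk : α → List β → Pivot U V) (base : ℕ) :
    List (α × List β) → Option (ℕ × Pivot U V) → Timed (Option (ℕ × Pivot U V))
  | [], best => op best
  | e :: es, best => do
    let k ← lengthT e.2
    let s ← op (base - k)
    match best with
    | none => scanT mk base es (some (s, mk e.1 e.2))
    | some b => do
      let c ← op (decide (s < b.1))
      if c then scanT mk base es (some (s, mk e.1 e.2)) else scanT mk base es (some b)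

/-- The choice of a pivot in `P ∪ X` that minimizes the size of `Q`. -/
def pivotT (S : Sets U V) : Timed (Option (ℕ × Pivot U V)) := do
  let nu ← lengthT S.pu
  let nv ← lengthT S.pv
  let b₁ ← scanT (Pivot.left true) (nv + 1) S.pu none
  let b₂ ← scanT (Pivot.right true) (nu + 1) S.pv b₁
  let b₃ ← scanT (Pivot.left false) nv S.xu b₂
  scanT (Pivot.right false) nu S.xv b₃

/-- The computation of `Q`. -/
def branchT (S : Sets U V) : Pivot U V → Timed (List (U ⊕ V))
  | .left inP u l => do
    let es ← filterT (fun e => do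
      let b ← memT e.1 l
      op (!b)) S.pv
    let q ← mapT (fun e => op (Sum.inr e.1)) es
    if inP then op (Sum.inl u :: q) else op q
  | .right inP v l => do
    let es ← filterT (fun e => do
      let b ← memT e.1 l
      op (!b)) S.pu
    let q ← mapT (fun e => op (Sum.inl e.1)) es
    if inP then op (Sum.inr v :: q) else op q

/-- Write out `R ∪ P`. -/
def reportT (R : List (U ⊕ V)) (S : Sets U V) : Timed (List (U ⊕ V)) := do
  let a ← mapT (fun e => op (Sum.inl e.1)) S.pu
  let b ← mapT (fun e => op (Sum.inr e.1)) S.pv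
  let ab ← appendT a b
  appendT R ab

/-- The `for` loop over the vertices of `Q`; `rec` is the recursive call. -/
def loopT (rec : List (U ⊕ V) → Sets U V → List (List (U ⊕ V)) → Timed (List (List (U ⊕ V))))
    (R : List (U ⊕ V)) :
    List (U ⊕ V) → Sets U V → List (List (U ⊕ V)) → Timed (List (List (U ⊕ V)))
  | [], _, out => op out
  | .inl u :: qs, S, out => do
    let nu ← lookupT u S.pu
    let S' ← childT u nu S
    let out' ← rec (.inl u :: R) S' out
    let S'' ← moveT u nu S
    loopT rec R qs S'' out'
  | .inr v :: qs, S, out => do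
    let nv ← lookupT v S.pv
    let S' ← childT v nv S.swap
    let out' ← rec (.inr v :: R) S'.swap out
    let S'' ← moveT v nv S.swap
    loopT rec R qs S''.swap out'

/-- The recursive function. The first argument only bounds the depth of the recursion. -/
def callT : ℕ → List (U ⊕ V) → Sets U V → List (List (U ⊕ V)) → Timed (List (List (U ⊕ V)))
  | 0, _, _, out => op out
  | n + 1, R, S, out => do
    let c₁ ← op ((S.pu.isEmpty || S.pv.isEmpty) && (S.xu.isEmpty && S.xv.isEmpty))
    if c₁ then do
      let B ← reportT R S
      op (B :: out)
    else do
      let c₂ ← op ((S.pu.isEmpty && !S.xv.isEmpty) || (S.pv.isEmpty && !S.xu.isEmpty))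
      if c₂ then op out
      else do
        let p ← pivotT S
        match p with
        | none => op out
        | some b => do
          let qs ← branchT S b.2
          loopT (callT n) R qs S out

end Recursion

section Order

variable {U V : Type} [DecidableEq U] [DecidableEq V] {E : Finset (U × V)}

/-- Add the vertices of a list, other than `u`, to `acc`, without repetitions. -/
def addNewT (u : U) : List U → List U → Timed (List U)
  | [], acc => op acc
  | w :: ws, acc => do
    let c ← op (decide (w = u))
    if c then addNewT u ws acc
    else do
      let d ← memT w acc
      if d then addNewT u ws acc else addNewT u ws (w :: acc)

/-- The union of the neighbourhoods of the vertices of a list, without `u`, added to `acc`. -/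
def nbr2T (A : AdjLists E) (u : U) : List V → List U → Timed (List U)
  | [], acc => op acc
  | v :: vs, acc => do
    let ws ← op (A.nbrV v)
    let acc' ← addNewT u ws acc
    nbr2T A u vs acc'

/-- For each vertex `u` of a list, compute `N₂(u)` and `|Nᴾ(u)|` and store them in the arrays `n2`
and `cnt`; the last component is the maximum of the `|Nᴾ(u)|`. -/
def prepareT (A : AdjLists E) :
    List U → (U → List U) → (U → ℕ) → ℕ → Timed ((U → List U) × (U → ℕ) × ℕ)
  | [], n2, cnt, mx => op (n2, cnt, mx)
  | u :: us, n2, cnt, mx => do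
    let nu ← op (A.nbrU u)
    let l ← nbr2T A u nu []
    let k₁ ← lengthT nu
    let k₂ ← lengthT l
    let n2' ← op (Function.update n2 u l)
    let cnt' ← op (Function.update cnt u (k₁ + k₂))
    let mx' ← op (max mx (k₁ + k₂))
    prepareT A us n2' cnt' mx'

/-- Put each vertex `u` of a list into the bucket with number `cnt u`. -/
def fillT (cnt : U → ℕ) : List U → (ℕ → List U) → Timed (ℕ → List U)
  | [], B => op B
  | u :: us, B => do
    let k ← op (cnt u)
    let l ← op (B k)
    let B' ← op (Function.update B k (u :: l))
    fillT cnt us B'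

/-- Discard the vertices at the head of bucket `k` that are selected already (`sel`) or that have
moved to another bucket in the meantime. -/
def purgeT (cnt : U → ℕ) (sel : U → Bool) (k : ℕ) : List U → Timed (List U)
  | [] => op []
  | u :: l => do
    let d ← op (sel u)
    let c ← op (cnt u)
    let b ← op (d || decide (c ≠ k))
    if b then purgeT cnt sel k l else op (u :: l)

/-- Take a vertex from the first nonempty one of the `n` buckets `k, k + 1, …`. -/
def findMinT (cnt : U → ℕ) (sel : U → Bool) :
    ℕ → ℕ → (ℕ → List U) → Timed (Option (U × (ℕ → List U)))
  | 0, _, _ => op none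
  | n + 1, k, B => do
    let l ← op (B k)
    let l' ← purgeT cnt sel k l
    match l' with
    | [] => do
      let B' ← op (Function.update B k [])
      findMinT cnt sel n (k + 1) B'
    | u :: r => do
      let B' ← op (Function.update B k r)
      op (some (u, B'))

/-- Decrease `cnt w` by one for the vertices `w` of a list that are not selected. -/
def decrT (sel : U → Bool) :
    List U → (U → ℕ) → (ℕ → List U) → Timed ((U → ℕ) × (ℕ → List U))
  | [], cnt, B => op (cnt, B)
  | w :: ws, cnt, B => do
    let d ← op (sel w)
    if d then decrT sel ws cnt B
    else do
      let c ← op (cnt w)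
      let cnt' ← op (Function.update cnt w (c - 1))
      let l ← op (B (c - 1))
      let B' ← op (Function.update B (c - 1) (w :: l))
      decrT sel ws cnt' B'

/-- Select a vertex `u` with smallest `cnt u`, `n` times; the result lists the selected vertices. -/
def selectT (n2 : U → List U) (mx : ℕ) :
    ℕ → (U → ℕ) → (U → Bool) → (ℕ → List U) → Timed (List U)
  | 0, _, _, _ => op []
  | n + 1, cnt, sel, B => do
    let r ← findMinT cnt sel (mx + 1) 0 B
    match r with
    | none => op []
    | some (u, B₁) => do
      let sel' ← op (Function.update sel u true)
      let l ← op (n2 u)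
      let s ← decrT sel' l cnt B₁
      let us ← selectT n2 mx n s.1 sel' s.2
      op (u :: us)

/-- Computation of a bidegeneracy order and of the array of the sets `N₂(u)`. -/
def orderT (A : AdjLists E) : Timed (List U × (U → List U)) := do
  let n ← lengthT A.verts
  let n2₀ ← alloc n []
  let cnt₀ ← alloc n 0
  let s ← prepareT A A.verts n2₀ cnt₀ 0
  let B₀ ← alloc (s.2.2 + 1) []
  let B ← fillT s.2.1 A.verts B₀
  let sel ← alloc n false
  let us ← selectT s.1 s.2.2 n s.2.1 sel B
  op (us, s.1)

end Order

section Main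

variable {U V : Type} [DecidableEq U] [DecidableEq V] {E : Finset (U × V)}

/-- The entries `(x, N(x) ∩ k)` for the vertices `x` of a list, where `nb` has the lists `N(x)`. -/
def entriesT {α β : Type} [DecidableEq β] (nb : α → List β) (k : List β) (l : List α) :
    Timed (List (α × List β)) :=
  mapT (fun x => do
    let nx ← op (nb x)
    let r ← interT k nx
    op (x, r)) l

/-- The outer loop; the array `seen` marks the vertices of `U` that have been treated. -/
def outerT (A : AdjLists E) (n2 : U → List U) :
    List U → (U → Bool) → List (List (U ⊕ V)) → Timed (List (List (U ⊕ V)))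
  | [], _, out => op out
  | u :: us, seen, out => do
    let nu ← op (A.nbrU u)
    let l ← op (n2 u)
    let p ← filterT (fun w => op (!seen w)) l
    let x ← filterT (fun w => op (seen w)) l
    let pu ← entriesT A.nbrU nu p
    let pv ← entriesT A.nbrV p nu
    let xu ← entriesT A.nbrU nu x
    let k₁ ← lengthT pu
    let k₂ ← lengthT pv
    let out' ← callT (k₁ + k₂ + 1) [Sum.inl u] ⟨pu, pv, xu, []⟩ out
    let seen' ← op (Function.update seen u true)
    outerT A n2 us seen' out'

/-- The whole algorithm: computation of a bidegeneracy order, then the enumeration. The value is the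
list of the sets that are output, the most recent one first. -/
def bbkT (A : AdjLists E) : Timed (List (List (U ⊕ V))) := do
  let s ← orderT A
  let n ← lengthT A.verts
  let seen ← alloc n false
  outerT A s.2 s.1 seen []

end Main

end BBK

-- Correctness is a simulation. The four entry lists represent `P` and `X` exactly (`Represents`),
-- every list operation acts on these sets as the pseudocode prescribes, and so each run of the code
-- is a derivation in `Call`, `Loop` and `Outer`.
--
-- For the time of one recursive call, let `p = |P|` and `k = |Q|`. For `x ∈ P` the set `Q(x)` is
-- exactly `P \ P_x` (`branchSet_eq_sdiff`). The pivot is minimal over `P ∪ X` and `Q ⊆ P`, so each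
-- branching vertex was itself a candidate and its child loses at least `k` vertices: there are `k`
-- children, each of size at most `p - k`. The work per child outside the recursion is at most a
-- constant times `(|R| + |P| + |X| + 1) (p + 1)²`. The first factor never grows down the recursion,
-- so it comes out as a factor, and what remains is `T(p) ≤ k T(p - k) + (p + 1)³`. As `k ≤ 3^(k/3)`
-- for natural `k`, with equality only at `k = 3`, the solution is `O(3^(p/3))`
-- (`exists_isBranchBound`, `callT_spec`).
--
-- In a bidegeneracy order the top-level calls have `|P| ≤ b_U` (`card_projNbr_sdiff_le`). A single
-- `X` need not be that small, but it contains only earlier vertices of `U` with a common neighbour,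
-- and each such pair is also seen from its earlier vertex, where it counts towards `P`. Hence the
-- sizes of all top-level `X` sum to at most `ν b_U` (`backPairs_le`). Since a call costs only
-- linearly in `|X|`, all calls together take `O(ν b_U 3^(b_U/3))` steps.
--
-- The order comes from a bucket queue with lazy deletion. Degrees on both sides are at most `b_U`
-- (`card_nbrs_le`, `card_filter_mem_le`), so `|N₂(u)| ≤ b_U²`, and ordering and preparation cost
-- `ν` times a polynomial in `b_U`, which the exponential absorbs.

namespace BBK

/-! ### Values and running times of the list operations -/

section Basic

variable {α β : Type}

@[simp] theorem val_bind (x : Timed α) (f : α → Timed β) : (x >>= f).val = (f x.val).val := rfl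

@[simp] theorem time_bind (x : Timed α) (f : α → Timed β) :
    (x >>= f).time = x.time + (f x.val).time := rfl

@[simp] theorem val_op (a : α) : (op a).val = a := rfl

@[simp] theorem time_op (a : α) : (op a).time = 1 := rfl

@[simp] theorem val_ite (c : Prop) [Decidable c] (x y : Timed α) :
    (if c then x else y).val = if c then x.val else y.val := apply_ite _ _ _ _

@[simp] theorem time_ite (c : Prop) [Decidable c] (x y : Timed α) :
    (if c then x else y).time = if c then x.time else y.time := apply_ite _ _ _ _

@[simp] theorem lengthT_val (l : List α) : (lengthT l).val = l.length := by
  induction l with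
  | nil => rfl
  | cons a l ih => simp [lengthT, ih]

@[simp] theorem lengthT_time (l : List α) : (lengthT l).time = l.length + 1 := by
  induction l with
  | nil => rfl
  | cons a l ih => simp [lengthT, ih]

@[simp] theorem appendT_val (l k : List α) : (appendT l k).val = l ++ k := by
  induction l with
  | nil => rfl
  | cons a l ih => simp [appendT, ih]

@[simp] theorem appendT_time (l k : List α) : (appendT l k).time = l.length + 1 := by
  induction l with
  | nil => rfl
  | cons a l ih => simp [appendT, ih]

@[simp] theorem mapT_val (f : α → Timed β) (l : List α) :
    (mapT f l).val = l.map fun a => (f a).val := by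
  induction l with
  | nil => rfl
  | cons a l ih => simp [mapT, ih]

theorem mapT_time_le (f : α → Timed β) (c : ℕ) (l : List α) (h : ∀ a ∈ l, (f a).time ≤ c) :
    (mapT f l).time ≤ l.length * (c + 1) + 1 := by
  induction l with
  | nil => simp [mapT]
  | cons a l ih =>
    have h₁ := h a (by simp)
    have h₂ := ih fun b hb => h b (by simp [hb])
    simp only [mapT, time_bind, time_op, List.length_cons]
    linarith

@[simp] theorem filterT_val (q : α → Timed Bool) (l : List α) :
    (filterT q l).val = l.filter fun a => (q a).val := by
  induction l with
  | nil => rfl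
  | cons a l ih =>
    simp only [filterT, val_bind, val_ite, val_op, ih, List.filter_cons]

theorem filterT_time_le (q : α → Timed Bool) (c : ℕ) (l : List α)
    (h : ∀ a ∈ l, (q a).time ≤ c) : (filterT q l).time ≤ l.length * (c + 1) + 1 := by
  induction l with
  | nil => simp [filterT]
  | cons a l ih =>
    have h₁ := h a (by simp)
    have h₂ := ih fun b hb => h b (by simp [hb])
    simp only [filterT, time_bind, time_ite, time_op, List.length_cons, ite_self]
    linarith

@[simp] theorem memT_val [DecidableEq α] (a : α) (l : List α) : (memT a l).val = decide (a ∈ l) := by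
  induction l with
  | nil => simp [memT]
  | cons b l ih =>
    by_cases h : a = b <;> simp [memT, ih, h]

theorem memT_time_le [DecidableEq α] (a : α) (l : List α) : (memT a l).time ≤ l.length + 1 := by
  induction l with
  | nil => simp [memT]
  | cons b l ih =>
    by_cases h : a = b
    · simp [memT, h]
    · simp [memT, h]; omega

@[simp] theorem interT_val [DecidableEq α] (k l : List α) : (interT k l).val = l.filter (· ∈ k) := by
  simp [interT]

theorem interT_time_le [DecidableEq α] (k l : List α) :
    (interT k l).time ≤ l.length * (k.length + 2) + 1 :=
  filterT_time_le _ _ _ fun _ _ => memT_time_le _ _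

@[simp] theorem eraseT_val [DecidableEq α] (x : α) (l : List α) : (eraseT x l).val = l.filter (· ≠ x) := by
  simp [eraseT]

theorem eraseT_time_le [DecidableEq α] (x : α) (l : List α) : (eraseT x l).time ≤ l.length * 2 + 1 :=
  filterT_time_le _ _ _ fun _ _ => le_rfl

theorem lookupT_time_le [DecidableEq α] (x : α) (es : List (α × List β)) :
    (lookupT x es).time ≤ es.length + 1 := by
  induction es with
  | nil => simp [lookupT]
  | cons e es ih =>
    by_cases h : e.1 = x
    · simp [lookupT, h]
    · simp [lookupT, h]; omega

theorem lookupT_mem [DecidableEq α] {x : α} {es : List (α × List β)} (h : x ∈ es.map Prod.fst) :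
    (x, (lookupT x es).val) ∈ es := by
  induction es with
  | nil => simp at h
  | cons e es ih =>
    by_cases hx : e.1 = x
    · subst hx; simp [lookupT]
    · have : x ∈ es.map Prod.fst := by
        rw [List.map_cons, List.mem_cons] at h
        exact h.resolve_left fun h' => hx h'.symm
      simpa [lookupT, hx] using Or.inr (ih this)

@[simp] theorem dropT_val [DecidableEq α] (x : α) (es : List (α × List β)) :
    (dropT x es).val = es.filter (·.1 ≠ x) := by
  simp [dropT]

theorem dropT_time_le [DecidableEq α] (x : α) (es : List (α × List β)) :
    (dropT x es).time ≤ es.length * 2 + 1 :=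
  filterT_time_le _ _ _ fun _ _ => le_rfl

@[simp] theorem restrictT_val [DecidableEq β] (k : List β) (es : List (α × List β)) :
    (restrictT k es).val = es.map fun e => (e.1, e.2.filter (· ∈ k)) := by
  simp [restrictT]

theorem restrictT_time_le [DecidableEq β] {p : ℕ} (k : List β) (es : List (α × List β))
    (hk : k.length ≤ p) (h : ∀ e ∈ es, e.2.length ≤ p) :
    (restrictT k es).time ≤ es.length * (p * (p + 2) + 3) + 1 := by
  refine mapT_time_le _ _ _ fun e he => ?_
  have h₁ := interT_time_le k e.2
  have h₂ : e.2.length * (k.length + 2) ≤ p * (p + 2) := by gcongr; exact h e he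
  simp only [time_bind, time_op]
  omega

@[simp] theorem eraseNbrT_val [DecidableEq β] (x : β) (es : List (α × List β)) :
    (eraseNbrT x es).val = es.map fun e => (e.1, e.2.filter (· ≠ x)) := by
  simp [eraseNbrT]

theorem eraseNbrT_time_le [DecidableEq β] {p : ℕ} (x : β) (es : List (α × List β))
    (h : ∀ e ∈ es, e.2.length ≤ p) :
    (eraseNbrT x es).time ≤ es.length * (p * 2 + 3) + 1 := by
  refine mapT_time_le _ _ _ fun e he => ?_
  have h₁ := eraseT_time_le x e.2
  have h₂ := h e he
  simp only [time_bind, time_op]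
  omega

@[simp] theorem keepT_val [DecidableEq β] (x : β) (es : List (α × List β)) :
    (keepT x es).val = (es.filter (x ∈ ·.2)).map fun e => (e.1, e.2.filter (· ≠ x)) := by
  simp [keepT]

theorem keepT_time_le [DecidableEq β] {p : ℕ} (x : β) (es : List (α × List β))
    (h : ∀ e ∈ es, e.2.length ≤ p) :
    (keepT x es).time ≤ es.length * (p * 3 + 5) + 2 := by
  have h₁ : (filterT (fun e : α × List β => memT x e.2) es).time ≤ es.length * (p + 2) + 1 :=
    filterT_time_le _ _ _ fun e he => (memT_time_le _ _).trans (by have := h e he; omega)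
  have h₂ := eraseNbrT_time_le (p := p) x (filterT (fun e : α × List β => memT x e.2) es).val
    fun e he => by
      rw [filterT_val] at he
      exact h e (List.mem_of_mem_filter he)
  have h₃ : (filterT (fun e : α × List β => memT x e.2) es).val.length ≤ es.length := by
    rw [filterT_val]; exact List.length_filter_le _ _
  have h₄ := Nat.mul_le_mul_right (p * 2 + 3) h₃
  simp only [keepT, time_bind]
  linarith

end Basic

/-! ### The sets represented by lists of entries -/

section Represents

/-- The vertices of the entries of a list. -/
def keys {α β : Type} (es : List (α × List β)) : List α := es.map Prod.fst

/-- The entries store, without repetitions, the neighbours that lie in `k`. -/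
def Exact {α β : Type} (r : α → β → Prop) (k : List β) (es : List (α × List β)) : Prop :=
  ∀ e ∈ es, e.2.Nodup ∧ ∀ b, b ∈ e.2 ↔ b ∈ k ∧ r e.1 b

variable {α β : Type}

@[simp] theorem length_keys (es : List (α × List β)) : (keys es).length = es.length := by
  simp [keys]

theorem mem_keys_of_mem {es : List (α × List β)} {e : α × List β} (h : e ∈ es) : e.1 ∈ keys es :=
  List.mem_map_of_mem h

/-- Lists attached to vertices of `X` also contain only vertices of `P`. Their length is therefore
bounded by `|P|`, which keeps the cost of a call linear in `|X|`. -/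
theorem Exact.length_le {r : α → β → Prop} {k : List β} {es : List (α × List β)}
    (h : Exact r k es) : ∀ e ∈ es, e.2.length ≤ k.length := fun e he =>
  ((h e he).1.subperm fun b hb => ((h e he).2 b).1 hb |>.1).length_le

@[simp] theorem keys_map_snd (f : α × List β → List β) (es : List (α × List β)) :
    keys (es.map fun e => (e.1, f e)) = keys es := by
  simp [keys, Function.comp_def]

theorem keys_filter_sublist (q : α × List β → Bool) (es : List (α × List β)) :
    (keys (es.filter q)).Sublist (keys es) := List.filter_sublist.map _

theorem mem_keys_drop [DecidableEq α] {x a : α} {es : List (α × List β)} :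
    a ∈ keys (es.filter (·.1 ≠ x)) ↔ a ∈ keys es ∧ a ≠ x := by
  simp only [keys, List.mem_map, List.mem_filter, decide_eq_true_eq]
  constructor
  · rintro ⟨e, ⟨he, hx⟩, rfl⟩; exact ⟨⟨e, he, rfl⟩, hx⟩
  · rintro ⟨⟨e, he, rfl⟩, hx⟩; exact ⟨e, ⟨he, hx⟩, rfl⟩

/-- Adjacency to `x` can be read off the stored lists only because `x` itself is still in `k`. -/
theorem Exact.mem_keys_keep [DecidableEq β] {r : α → β → Prop} {k : List β}
    {es : List (α × List β)} (h : Exact r k es) {x : β} (hx : x ∈ k) {a : α} :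
    a ∈ keys (es.filter (x ∈ ·.2)) ↔ a ∈ keys es ∧ r a x := by
  simp only [keys, List.mem_map, List.mem_filter, decide_eq_true_eq]
  constructor
  · rintro ⟨e, ⟨he, hxe⟩, rfl⟩
    exact ⟨⟨e, he, rfl⟩, (((h e he).2 x).1 hxe).2⟩
  · rintro ⟨⟨e, he, rfl⟩, hr⟩
    exact ⟨e, ⟨he, ((h e he).2 x).2 ⟨hx, hr⟩⟩, rfl⟩

theorem Exact.sub {r : α → β → Prop} {k : List β} {es es' : List (α × List β)}
    (h : Exact r k es) (hs : es' ⊆ es) : Exact r k es' := fun e he => h e (hs he)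

theorem Exact.map_filter {r : α → β → Prop} {k k' : List β} {es : List (α × List β)}
    (h : Exact r k es) (q : β → Bool) (hk : ∀ b, b ∈ k' ↔ b ∈ k ∧ q b = true) :
    Exact r k' (es.map fun e => (e.1, e.2.filter q)) := by
  intro e he
  obtain ⟨e, he', rfl⟩ := List.mem_map.1 he
  refine ⟨(h e he').1.filter _, fun b => ?_⟩
  rw [List.mem_filter, (h e he').2, hk]
  tauto

variable {U V : Type}

/-- The four lists of entries represent disjoint sets `P` and `X` of vertices. -/
structure Represents (r : U → V → Prop) (S : Sets U V) : Prop where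
  nodupU : (keys S.pu ++ keys S.xu).Nodup
  nodupV : (keys S.pv ++ keys S.xv).Nodup
  pu : Exact r (keys S.pv) S.pu
  pv : Exact (fun v u => r u v) (keys S.pu) S.pv
  xu : Exact r (keys S.pv) S.xu
  xv : Exact (fun v u => r u v) (keys S.pu) S.xv

theorem Represents.swap {r : U → V → Prop} {S : Sets U V} (h : Represents r S) :
    Represents (fun v u => r u v) S.swap :=
  ⟨h.nodupV, h.nodupU, h.pv, h.pu, h.xv, h.xu⟩

variable [DecidableEq U]

theorem childT_val [DecidableEq V] (x : U) (nx : List V) (S : Sets U V) :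
    (childT x nx S).val =
      ⟨(S.pu.filter (·.1 ≠ x)).map fun e => (e.1, e.2.filter (· ∈ nx)),
        (S.pv.filter (x ∈ ·.2)).map fun e => (e.1, e.2.filter (· ≠ x)),
        S.xu.map fun e => (e.1, e.2.filter (· ∈ nx)),
        (S.xv.filter (x ∈ ·.2)).map fun e => (e.1, e.2.filter (· ≠ x))⟩ := by
  simp [childT]

theorem moveT_val (x : U) (nx : List V) (S : Sets U V) :
    (moveT x nx S).val =
      ⟨S.pu.filter (·.1 ≠ x), S.pv.map fun e => (e.1, e.2.filter (· ≠ x)), (x, nx) :: S.xu,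
        S.xv.map fun e => (e.1, e.2.filter (· ≠ x))⟩ := by
  simp [moveT]

theorem Represents.mem_childT [DecidableEq V] {r : U → V → Prop} {S : Sets U V} (h : Represents r S) {x : U}
    {nx : List V} (hx : (x, nx) ∈ S.pu) :
    (∀ u, u ∈ keys (childT x nx S).val.pu ↔ u ∈ keys S.pu ∧ u ≠ x) ∧
    (∀ v, v ∈ keys (childT x nx S).val.pv ↔ v ∈ keys S.pv ∧ r x v) ∧
    (∀ u, u ∈ keys (childT x nx S).val.xu ↔ u ∈ keys S.xu) ∧
    (∀ v, v ∈ keys (childT x nx S).val.xv ↔ v ∈ keys S.xv ∧ r x v) := by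
  simp only [childT_val, keys_map_snd]
  exact ⟨fun u => mem_keys_drop, fun v => h.pv.mem_keys_keep (mem_keys_of_mem hx),
    fun u => trivial, fun v => h.xv.mem_keys_keep (mem_keys_of_mem hx)⟩

theorem Represents.childT [DecidableEq V] {r : U → V → Prop} {S : Sets U V} (h : Represents r S) {x : U}
    {nx : List V} (hx : (x, nx) ∈ S.pu) : Represents r (childT x nx S).val := by
  obtain ⟨mpu, mpv, -, -⟩ := h.mem_childT hx
  have hnx := (h.pu _ hx).2
  -- The new `P_V` is `P_V ∩ N(x)`, which is the list `nx` itself; intersecting the stored lists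
  -- with `nx` thus keeps them exact.
  have hpv : ∀ v, v ∈ keys (BBK.childT x nx S).val.pv ↔ v ∈ keys S.pv ∧ decide (v ∈ nx) = true := by
    intro v
    rw [mpv, decide_eq_true_eq, hnx]
    tauto
  have hpu : ∀ u, u ∈ keys (BBK.childT x nx S).val.pu ↔ u ∈ keys S.pu ∧ decide (u ≠ x) = true := by
    intro u
    rw [mpu, decide_eq_true_eq]
  rw [childT_val] at hpv hpu ⊢
  refine ⟨?_, ?_, ?_, ?_, ?_, ?_⟩
  · simp only [keys_map_snd]
    exact h.nodupU.sublist ((keys_filter_sublist _ _).append (List.Sublist.refl _))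
  · simp only [keys_map_snd]
    exact h.nodupV.sublist ((keys_filter_sublist _ _).append (keys_filter_sublist _ _))
  · exact (h.pu.sub List.filter_sublist.subset).map_filter _ hpv
  · exact (h.pv.sub List.filter_sublist.subset).map_filter _ hpu
  · exact h.xu.map_filter _ hpv
  · exact (h.xv.sub List.filter_sublist.subset).map_filter _ hpu

theorem mem_moveT (S : Sets U V) (x : U) (nx : List V) :
    (∀ u, u ∈ keys (moveT x nx S).val.pu ↔ u ∈ keys S.pu ∧ u ≠ x) ∧
    (∀ v, v ∈ keys (moveT x nx S).val.pv ↔ v ∈ keys S.pv) ∧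
    (∀ u, u ∈ keys (moveT x nx S).val.xu ↔ u = x ∨ u ∈ keys S.xu) ∧
    (∀ v, v ∈ keys (moveT x nx S).val.xv ↔ v ∈ keys S.xv) := by
  simp only [moveT_val, keys_map_snd]
  exact ⟨fun u => mem_keys_drop, fun v => trivial, fun u => by simp [keys], fun v => trivial⟩

theorem Represents.moveT {r : U → V → Prop} {S : Sets U V} (h : Represents r S) {x : U}
    {nx : List V} (hx : (x, nx) ∈ S.pu) : Represents r (moveT x nx S).val := by
  have hpu : ∀ u, u ∈ keys (BBK.moveT x nx S).val.pu ↔ u ∈ keys S.pu ∧ decide (u ≠ x) = true := by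
    intro u
    rw [(mem_moveT S x nx).1, decide_eq_true_eq]
  rw [moveT_val] at hpu ⊢
  have hn := List.nodup_append'.1 h.nodupU
  have hxk := mem_keys_of_mem hx
  refine ⟨?_, ?_, ?_, ?_, ?_, ?_⟩
  · refine List.nodup_append'.2 ⟨hn.1.sublist (keys_filter_sublist _ _), ?_, ?_⟩
    · exact List.nodup_cons.2 ⟨fun h' => hn.2.2 hxk h', hn.2.1⟩
    · intro u hu hu'
      rw [mem_keys_drop] at hu
      rcases List.mem_cons.1 hu' with rfl | hu'
      · exact hu.2 rfl
      · exact hn.2.2 hu.1 hu'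
  · simpa only [keys_map_snd] using h.nodupV
  · simp only [keys_map_snd]
    exact h.pu.sub List.filter_sublist.subset
  · exact h.pv.map_filter _ hpu
  · simp only [keys_map_snd]
    intro e he
    -- The entry of `x` moves to `X` unchanged: only the side of `x` loses a vertex, and its list
    -- refers to the other side.
    rcases List.mem_cons.1 he with rfl | he
    · exact h.pu _ hx
    · exact h.xu _ he
  · exact h.xv.map_filter _ hpu

/-- The number of vertices of `P`. -/
def Sets.cardP (S : Sets U V) : ℕ := S.pu.length + S.pv.length

/-- The number of vertices of `X`. -/
def Sets.cardX (S : Sets U V) : ℕ := S.xu.length + S.xv.length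

/-- The dominant cost is one intersection of two lists of length at most `p` per entry. Entries of
`X` cost no more than those of `P`. -/
theorem childT_time_le [DecidableEq V] {p : ℕ} (x : U) (nx : List V) (S : Sets U V) (hnx : nx.length ≤ p)
    (hpu : ∀ e ∈ S.pu, e.2.length ≤ p) (hpv : ∀ e ∈ S.pv, e.2.length ≤ p)
    (hxu : ∀ e ∈ S.xu, e.2.length ≤ p) (hxv : ∀ e ∈ S.xv, e.2.length ≤ p) :
    (childT x nx S).time ≤ (S.cardP + S.cardX + 1) * (8 * (p + 1) ^ 2) := by
  have h₁ := dropT_time_le x S.pu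
  have h₂ := restrictT_time_le nx (dropT x S.pu).val hnx fun e he => by
    rw [dropT_val] at he
    exact hpu e (List.mem_of_mem_filter he)
  have h₃ := keepT_time_le x S.pv hpv
  have h₄ := restrictT_time_le nx S.xu hnx hxu
  have h₅ := keepT_time_le x S.xv hxv
  have h₆ : (dropT x S.pu).val.length ≤ S.pu.length := by
    rw [dropT_val]; exact List.length_filter_le _ _
  have h₇ : (dropT x S.pu).val.length * (p * (p + 2) + 3) ≤ S.pu.length * (p * (p + 2) + 3) :=
    Nat.mul_le_mul_right _ h₆
  simp only [childT, time_bind, time_op, Sets.cardP, Sets.cardX]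
  nlinarith [mul_nonneg (Nat.zero_le S.pu.length) (Nat.zero_le p),
    mul_nonneg (Nat.zero_le S.pv.length) (Nat.zero_le p),
    mul_nonneg (Nat.zero_le S.xu.length) (Nat.zero_le p),
    mul_nonneg (Nat.zero_le S.xv.length) (Nat.zero_le p),
    mul_nonneg (Nat.zero_le S.pu.length) (Nat.zero_le (p ^ 2)),
    mul_nonneg (Nat.zero_le S.pv.length) (Nat.zero_le (p ^ 2)),
    mul_nonneg (Nat.zero_le S.xu.length) (Nat.zero_le (p ^ 2)),
    mul_nonneg (Nat.zero_le S.xv.length) (Nat.zero_le (p ^ 2))]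

theorem moveT_time_le {p : ℕ} (x : U) (nx : List V) (S : Sets U V)
    (hpv : ∀ e ∈ S.pv, e.2.length ≤ p) (hxv : ∀ e ∈ S.xv, e.2.length ≤ p) :
    (moveT x nx S).time ≤ (S.cardP + S.cardX + 1) * (8 * (p + 1) ^ 2) := by
  have h₁ := dropT_time_le x S.pu
  have h₂ := eraseNbrT_time_le x S.pv hpv
  have h₃ := eraseNbrT_time_le x S.xv hxv
  simp only [moveT, time_bind, time_op, Sets.cardP, Sets.cardX]
  nlinarith [mul_nonneg (Nat.zero_le S.pu.length) (Nat.zero_le p),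
    mul_nonneg (Nat.zero_le S.pv.length) (Nat.zero_le p),
    mul_nonneg (Nat.zero_le S.xu.length) (Nat.zero_le p),
    mul_nonneg (Nat.zero_le S.xv.length) (Nat.zero_le p),
    mul_nonneg (Nat.zero_le S.pu.length) (Nat.zero_le (p ^ 2)),
    mul_nonneg (Nat.zero_le S.pv.length) (Nat.zero_le (p ^ 2)),
    mul_nonneg (Nat.zero_le S.xu.length) (Nat.zero_le (p ^ 2)),
    mul_nonneg (Nat.zero_le S.xv.length) (Nat.zero_le (p ^ 2))]

end Represents

/-! ### The recursive function -/

section Recursion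

variable {U V : Type}

@[simp] theorem mem_uPart {P : Finset (U ⊕ V)} {x : U ⊕ V} :
    x ∈ uPart P ↔ x ∈ P ∧ x.isLeft = true := by simp [uPart]

@[simp] theorem mem_vPart {P : Finset (U ⊕ V)} {x : U ⊕ V} :
    x ∈ vPart P ↔ x ∈ P ∧ x.isRight = true := by simp [vPart]

@[simp] theorem Sets.swap_pu (S : Sets U V) : S.swap.pu = S.pv := rfl

@[simp] theorem Sets.swap_pv (S : Sets U V) : S.swap.pv = S.pu := rfl

@[simp] theorem Sets.swap_xu (S : Sets U V) : S.swap.xu = S.xv := rfl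

@[simp] theorem Sets.swap_xv (S : Sets U V) : S.swap.xv = S.xu := rfl

variable [DecidableEq U] [DecidableEq V]

/-- The set `P`. -/
def Sets.pset (S : Sets U V) : Finset (U ⊕ V) :=
  (keys S.pu).toFinset.disjSum (keys S.pv).toFinset

/-- The set `X`. -/
def Sets.xset (S : Sets U V) : Finset (U ⊕ V) :=
  (keys S.xu).toFinset.disjSum (keys S.xv).toFinset

@[simp] theorem inl_mem_pset {S : Sets U V} {u : U} : Sum.inl u ∈ S.pset ↔ u ∈ keys S.pu := by
  simp [Sets.pset]

@[simp] theorem inr_mem_pset {S : Sets U V} {v : V} : Sum.inr v ∈ S.pset ↔ v ∈ keys S.pv := by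
  simp [Sets.pset]

@[simp] theorem inl_mem_xset {S : Sets U V} {u : U} : Sum.inl u ∈ S.xset ↔ u ∈ keys S.xu := by
  simp [Sets.xset]

@[simp] theorem inr_mem_xset {S : Sets U V} {v : V} : Sum.inr v ∈ S.xset ↔ v ∈ keys S.xv := by
  simp [Sets.xset]

theorem Represents.card_pset {r : U → V → Prop} {S : Sets U V} (h : Represents r S) :
    S.pset.card = S.cardP := by
  rw [Sets.pset, Finset.card_disjSum, List.toFinset_card_of_nodup h.nodupU.of_append_left,
    List.toFinset_card_of_nodup h.nodupV.of_append_left, length_keys, length_keys, Sets.cardP]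

theorem Represents.card_xset {r : U → V → Prop} {S : Sets U V} (h : Represents r S) :
    S.xset.card = S.cardX := by
  rw [Sets.xset, Finset.card_disjSum, List.toFinset_card_of_nodup h.nodupU.of_append_right,
    List.toFinset_card_of_nodup h.nodupV.of_append_right, length_keys, length_keys, Sets.cardX]

/-- The implementation of the sets `P_x`, `X_x`. -/
def childSets (S : Sets U V) : U ⊕ V → Sets U V
  | .inl u => (childT u (lookupT u S.pu).val S).val
  | .inr v => (childT v (lookupT v S.pv).val S.swap).val.swap

/-- The implementation of `P \ {x}`, `X ∪ {x}`. -/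
def moveSets (S : Sets U V) : U ⊕ V → Sets U V
  | .inl u => (moveT u (lookupT u S.pu).val S).val
  | .inr v => (moveT v (lookupT v S.pv).val S.swap).val.swap

variable {E : Finset (U × V)}

/-- The lists of entries represent sets of vertices of the graph with edge set `E`. -/
abbrev RepresentsIn (E : Finset (U × V)) (S : Sets U V) : Prop :=
  Represents (fun u v => (u, v) ∈ E) S

theorem Represents.childSets {S : Sets U V} (h : RepresentsIn E S) {x : U ⊕ V}
    (hx : x ∈ S.pset) : RepresentsIn E (childSets S x) := by
  cases x with
  | inl u => exact h.childT (lookupT_mem (inl_mem_pset.1 hx))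
  | inr v => exact (h.swap.childT (lookupT_mem (inr_mem_pset.1 hx))).swap

theorem Represents.moveSets {S : Sets U V} (h : RepresentsIn E S) {x : U ⊕ V}
    (hx : x ∈ S.pset) : RepresentsIn E (moveSets S x) := by
  cases x with
  | inl u => exact h.moveT (lookupT_mem (inl_mem_pset.1 hx))
  | inr v => exact (h.swap.moveT (lookupT_mem (inr_mem_pset.1 hx))).swap

theorem pset_moveSets (S : Sets U V) (x : U ⊕ V) : (moveSets S x).pset = S.pset \ {x} := by
  cases x with
  | inl u =>
    obtain ⟨h₁, h₂, -, -⟩ := mem_moveT S u (lookupT u S.pu).val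
    ext (w | w)
    · simp [moveSets, h₁]
    · simp [moveSets, h₂]
  | inr v =>
    obtain ⟨h₁, h₂, -, -⟩ := mem_moveT S.swap v (lookupT v S.pv).val
    ext (w | w)
    · simpa [moveSets] using h₂ w
    · simpa [moveSets] using h₁ w

theorem xset_moveSets (S : Sets U V) (x : U ⊕ V) : (moveSets S x).xset = S.xset ∪ {x} := by
  cases x with
  | inl u =>
    obtain ⟨-, -, h₁, h₂⟩ := mem_moveT S u (lookupT u S.pu).val
    ext (w | w)
    · simp [moveSets, h₁]
    · simp [moveSets, h₂]
  | inr v =>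
    obtain ⟨-, -, h₁, h₂⟩ := mem_moveT S.swap v (lookupT v S.pv).val
    ext (w | w)
    · simpa [moveSets] using h₂ w
    · simpa [moveSets, or_comm] using h₁ w

theorem uPart_pset_eq_empty {S : Sets U V} : uPart S.pset = ∅ ↔ S.pu = [] := by
  rw [← List.map_eq_nil_iff (f := Prod.fst), ← keys]
  simp [Finset.ext_iff, List.eq_nil_iff_forall_not_mem]

theorem vPart_pset_eq_empty {S : Sets U V} : vPart S.pset = ∅ ↔ S.pv = [] := by
  rw [← List.map_eq_nil_iff (f := Prod.fst), ← keys]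
  simp [Finset.ext_iff, List.eq_nil_iff_forall_not_mem]

theorem uPart_xset_eq_empty {S : Sets U V} : uPart S.xset = ∅ ↔ S.xu = [] := by
  rw [← List.map_eq_nil_iff (f := Prod.fst), ← keys]
  simp [Finset.ext_iff, List.eq_nil_iff_forall_not_mem]

theorem vPart_xset_eq_empty {S : Sets U V} : vPart S.xset = ∅ ↔ S.xv = [] := by
  rw [← List.map_eq_nil_iff (f := Prod.fst), ← keys]
  simp [Finset.ext_iff, List.eq_nil_iff_forall_not_mem]

theorem xset_eq_empty {S : Sets U V} : S.xset = ∅ ↔ S.xu = [] ∧ S.xv = [] := by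
  rw [← uPart_xset_eq_empty, ← vPart_xset_eq_empty]
  simp [Finset.ext_iff]

theorem reportTest_iff {S : Sets U V} : ReportTest S.pset S.xset ↔
    ((S.pu.isEmpty || S.pv.isEmpty) && (S.xu.isEmpty && S.xv.isEmpty)) = true := by
  rw [ReportTest, uPart_pset_eq_empty, vPart_pset_eq_empty, xset_eq_empty]
  simp

theorem stopTest_iff {S : Sets U V} : StopTest S.pset S.xset ↔
    ((S.pu.isEmpty && !S.xv.isEmpty) || (S.pv.isEmpty && !S.xu.isEmpty)) = true := by
  rw [StopTest, uPart_pset_eq_empty, vPart_pset_eq_empty, Ne, Ne, uPart_xset_eq_empty,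
    vPart_xset_eq_empty]
  simp

-- Children and branching sets in the graph

section Branching

variable [Fintype U] [Fintype V]

@[simp] theorem inl_mem_nbr_inl {u w : U} : (Sum.inl w : U ⊕ V) ∈ nbr E (.inl u) ↔ False := by
  simp [nbr]

@[simp] theorem inr_mem_nbr_inl {u : U} {v : V} : Sum.inr v ∈ nbr E (.inl u) ↔ (u, v) ∈ E := by
  simp [nbr]

@[simp] theorem inl_mem_nbr_inr {u : U} {v : V} : Sum.inl u ∈ nbr E (.inr v) ↔ (u, v) ∈ E := by
  simp [nbr]

@[simp] theorem inr_mem_nbr_inr {v w : V} : (Sum.inr w : U ⊕ V) ∈ nbr E (.inr v) ↔ False := by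
  simp [nbr]

theorem pset_childSets {S : Sets U V} (h : RepresentsIn E S) {x : U ⊕ V} (hx : x ∈ S.pset) :
    (childSets S x).pset = childP E S.pset x := by
  cases x with
  | inl u =>
    obtain ⟨h₁, h₂, -, -⟩ := h.mem_childT (lookupT_mem (inl_mem_pset.1 hx))
    ext (w | w)
    · simp [childSets, childP, h₁, and_comm]
    · simp [childSets, childP, h₂]
  | inr v =>
    obtain ⟨h₁, h₂, -, -⟩ := h.swap.mem_childT (lookupT_mem (inr_mem_pset.1 hx))
    ext (w | w)
    · simpa [childSets, childP] using h₂ w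
    · simpa [childSets, childP, and_comm] using h₁ w

theorem xset_childSets {S : Sets U V} (h : RepresentsIn E S) {x : U ⊕ V} (hx : x ∈ S.pset) :
    (childSets S x).xset = childX E S.xset x := by
  cases x with
  | inl u =>
    obtain ⟨-, -, h₁, h₂⟩ := h.mem_childT (lookupT_mem (inl_mem_pset.1 hx))
    ext (w | w)
    · simp [childSets, childX, h₁]
    · simp [childSets, childX, h₂]
  | inr v =>
    obtain ⟨-, -, h₁, h₂⟩ := h.swap.mem_childT (lookupT_mem (inr_mem_pset.1 hx))
    ext (w | w)
    · simpa [childSets, childX] using h₂ w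
    · simpa [childSets, childX] using h₁ w

theorem childP_subset (P : Finset (U ⊕ V)) (x : U ⊕ V) : childP E P x ⊆ P := by
  rcases x with x | x <;> rintro (w | w) <;> simp +contextual [childP]

/-- During the loop `P` only loses vertices, so size bounds on the children computed from the
initial `P` stay valid in later rounds. -/
theorem childP_mono {P Q : Finset (U ⊕ V)} (h : P ⊆ Q) (x : U ⊕ V) :
    childP E P x ⊆ childP E Q x := by
  rcases x with x | x <;> rintro (w | w) <;> simp +contextual [childP, @h (.inl _), @h (.inr _)]

theorem notMem_childP (P : Finset (U ⊕ V)) (x : U ⊕ V) : x ∉ childP E P x := by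
  rcases x with x | x <;> simp [childP]

theorem childX_subset (X : Finset (U ⊕ V)) (x : U ⊕ V) : childX E X x ⊆ X := by
  rcases x with x | x <;> rintro (w | w) <;> simp +contextual [childX]

theorem branchSet_subset (P : Finset (U ⊕ V)) (x : U ⊕ V) : branchSet E P x ⊆ P := by
  intro w
  by_cases hx : x ∈ P
  · rcases x with x | x <;> rcases w with w | w <;> simp +contextual [branchSet, hx]
  · rcases x with x | x <;> rcases w with w | w <;> simp +contextual [branchSet, hx]

/-- Passing to the child of `x` drops `x` and its non-neighbours on the opposite side, and these are
the vertices branched on with pivot `x`. This duality makes a small branching set the only obstacle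
to shrinking `P` fast. -/
theorem branchSet_eq_sdiff {P : Finset (U ⊕ V)} {x : U ⊕ V} (hx : x ∈ P) :
    branchSet E P x = P \ childP E P x := by
  ext w
  rcases x with x | x <;> rcases w with w | w <;> simp [branchSet, childP, hx]
  · grind
  · grind
  · grind
  · grind

theorem card_childP_add {P : Finset (U ⊕ V)} {x : U ⊕ V} (hx : x ∈ P) :
    (childP E P x).card + (branchSet E P x).card = P.card := by
  rw [branchSet_eq_sdiff hx, add_comm, Finset.card_sdiff_add_card_eq_card (childP_subset P x)]

end Branching

end Recursion
-- Choice of the pivot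
section Pivot

variable {U V : Type}

/-- `o` is a minimum of the list `l` of numbered objects, if there is one. -/
def IsMinOf {γ : Type} (o : Option (ℕ × γ)) (l : List (ℕ × γ)) : Prop :=
  match o with
  | none => l = []
  | some b => b ∈ l ∧ ∀ c ∈ l, b.1 ≤ c.1

theorem IsMinOf.snoc_lt {γ : Type} {b c : ℕ × γ} {l : List (ℕ × γ)} (h : IsMinOf (some b) l)
    (hc : c.1 < b.1) : IsMinOf (some c) (l ++ [c]) := by
  refine ⟨by simp, fun d hd => ?_⟩
  rcases List.mem_append.1 hd with hd | hd
  · exact hc.le.trans (h.2 d hd)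
  · rw [List.mem_singleton.1 hd]

theorem IsMinOf.snoc_ge {γ : Type} {b c : ℕ × γ} {l : List (ℕ × γ)} (h : IsMinOf (some b) l)
    (hc : b.1 ≤ c.1) : IsMinOf (some b) (l ++ [c]) := by
  refine ⟨by simp [h.1], fun d hd => ?_⟩
  rcases List.mem_append.1 hd with hd | hd
  · exact h.2 d hd
  · rw [List.mem_singleton.1 hd]; exact hc

/-- The list `l` stands for what earlier scans have seen, so that the four scans chain to a minimum
over the concatenation. -/
theorem scanT_isMinOf {α β : Type} (mk : α → List β → Pivot U V) (base : ℕ)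
    (es : List (α × List β)) : ∀ (best : Option (ℕ × Pivot U V)) (l : List (ℕ × Pivot U V)),
      IsMinOf best l →
      IsMinOf (scanT mk base es best).val (l ++ es.map fun e => (base - e.2.length, mk e.1 e.2)) := by
  induction es with
  | nil => intro best l h; simpa [scanT] using h
  | cons e es ih =>
    intro best l h
    rw [List.map_cons, List.append_cons]
    match best with
    | none =>
      obtain rfl : l = [] := h
      simpa [scanT] using ih (some (base - e.2.length, mk e.1 e.2)) [(base - e.2.length, mk e.1 e.2)]
        ⟨List.mem_singleton_self _, fun c hc => (List.mem_singleton.1 hc ▸ le_rfl)⟩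
    | some b =>
      by_cases hb : base - e.2.length < b.1
      · simpa [scanT, hb] using ih _ _ (h.snoc_lt (c := (base - e.2.length, mk e.1 e.2)) hb)
      · simpa [scanT, hb] using ih _ _
          (h.snoc_ge (c := (base - e.2.length, mk e.1 e.2)) (not_lt.1 hb))

theorem scanT_time_le {α β : Type} {p : ℕ} (mk : α → List β → Pivot U V) (base : ℕ)
    (es : List (α × List β)) (h : ∀ e ∈ es, e.2.length ≤ p) :
    ∀ best : Option (ℕ × Pivot U V), (scanT mk base es best).time ≤ es.length * (p + 3) + 1 := by
  induction es with
  | nil => intro best; simp [scanT]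
  | cons e es ih =>
    intro best
    have h₁ := h e (by simp)
    have h₂ := ih fun e' he' => h e' (by simp [he'])
    have h₃ : (e :: es).length * (p + 3) = es.length * (p + 3) + (p + 3) := by
      rw [List.length_cons]; ring
    rw [h₃]
    match best with
    | none =>
      have := h₂ (some (base - e.2.length, mk e.1 e.2))
      simp only [scanT, time_bind, lengthT_time, lengthT_val, val_op, time_op]
      omega
    | some b =>
      have h₄ := h₂ (some (base - e.2.length, mk e.1 e.2))
      have h₅ := h₂ (some b)
      by_cases hb : base - e.2.length < b.1
      · simp [scanT, hb]
        omega
      · simp [scanT, hb]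
        omega

/-- The pivot candidates, with the sizes of their branching sets. -/
def candidates (S : Sets U V) : List (ℕ × Pivot U V) :=
  (S.pu.map fun e => (S.pv.length + 1 - e.2.length, .left true e.1 e.2)) ++
  (S.pv.map fun e => (S.pu.length + 1 - e.2.length, .right true e.1 e.2)) ++
  (S.xu.map fun e => (S.pv.length - e.2.length, .left false e.1 e.2)) ++
  (S.xv.map fun e => (S.pu.length - e.2.length, .right false e.1 e.2))

theorem pivotT_isMinOf (S : Sets U V) : IsMinOf (pivotT S).val (candidates S) := by
  simp only [pivotT, val_bind, lengthT_val]
  exact scanT_isMinOf _ _ _ _ _ (scanT_isMinOf _ _ _ _ _ (scanT_isMinOf _ _ _ _ _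
    (scanT_isMinOf _ _ _ none [] rfl)))

/-- The vertex of a pivot. -/
def Pivot.vertex : Pivot U V → U ⊕ V
  | .left _ u _ => .inl u
  | .right _ v _ => .inr v

theorem exists_candidate {S : Sets U V} {x : U ⊕ V}
    (hx : x ∈ (keys S.pu).map .inl ++ (keys S.pv).map .inr ++ (keys S.xu).map .inl ++
      (keys S.xv).map .inr) : ∃ c ∈ candidates S, c.2.vertex = x := by
  simp only [List.mem_append, List.mem_map, keys] at hx
  simp only [candidates, List.mem_append, List.mem_map]
  rcases hx with ((⟨_, ⟨e, he, rfl⟩, rfl⟩ | ⟨_, ⟨e, he, rfl⟩, rfl⟩) | ⟨_, ⟨e, he, rfl⟩, rfl⟩) |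
    ⟨_, ⟨e, he, rfl⟩, rfl⟩
  · exact ⟨_, .inl (.inl (.inl ⟨e, he, rfl⟩)), rfl⟩
  · exact ⟨_, .inl (.inl (.inr ⟨e, he, rfl⟩)), rfl⟩
  · exact ⟨_, .inl (.inr ⟨e, he, rfl⟩), rfl⟩
  · exact ⟨_, .inr ⟨e, he, rfl⟩, rfl⟩

theorem Represents.pivotT_time_le {r : U → V → Prop} {S : Sets U V} (h : Represents r S) :
    (pivotT S).time ≤ (S.cardP + S.cardX + 1) * (8 * (S.cardP + 1) ^ 2) := by
  have hU : (keys S.pu).length ≤ S.cardP := by simp [Sets.cardP]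
  have hV : (keys S.pv).length ≤ S.cardP := by simp [Sets.cardP]
  have h₁ := scanT_time_le (Pivot.left (V := V) true) (S.pv.length + 1) S.pu
    (fun e he => (h.pu.length_le e he).trans hV) none
  have h₂ := scanT_time_le (Pivot.right (U := U) true) (S.pu.length + 1) S.pv
    (fun e he => (h.pv.length_le e he).trans hU)
  have h₃ := scanT_time_le (Pivot.left (V := V) false) S.pv.length S.xu
    (fun e he => (h.xu.length_le e he).trans hV)
  have h₄ := scanT_time_le (Pivot.right (U := U) false) S.pu.length S.xv
    (fun e he => (h.xv.length_le e he).trans hU)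
  simp only [pivotT, time_bind, lengthT_time, lengthT_val]
  refine (Nat.add_le_add_left (Nat.add_le_add_left (Nat.add_le_add h₁ (Nat.add_le_add (h₂ _)
    (Nat.add_le_add (h₃ _) (h₄ _)))) _) _).trans ?_
  have e₁ : S.pu.length + S.pv.length = S.cardP := rfl
  have e₂ : S.xu.length + S.xv.length = S.cardX := rfl
  generalize S.cardP = p at *
  generalize S.cardX = x at *
  calc _ = (p + x) * (p + 3) + (p + 6) := by rw [← e₁, ← e₂]; ring
    _ ≤ _ := by nlinarith [Nat.zero_le (x * p), Nat.zero_le (x * p ^ 2), Nat.zero_le (p ^ 2),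
                  Nat.zero_le (p ^ 3)]

/-- This justifies computing the size of a branching set by a subtraction, without forming the set.
-/
theorem length_filter_notMem {α : Type} [DecidableEq α] {k l : List α} (hk : k.Nodup)
    (hl : l.Nodup) (h : l ⊆ k) : (k.filter (· ∉ l)).length = k.length - l.length := by
  have h₁ : (k.filter (· ∈ l)).length = l.length := by
    refine ((List.perm_ext_iff_of_nodup (hk.filter _) hl).2 fun a => ?_).length_eq
    simpa [List.mem_filter] using @h a
  have h₂ := List.length_eq_length_filter_add (l := k) (fun a => decide (a ∈ l))
  simp only [decide_not] at h₂ ⊢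
  omega

theorem keys_filter_fst {α β : Type} (q : α → Bool) (es : List (α × List β)) :
    keys (es.filter fun e => q e.1) = (keys es).filter q := by
  simp only [keys, List.filter_map]
  rfl

variable [DecidableEq U] [DecidableEq V]

theorem branchT_left_val (S : Sets U V) (b : Bool) (u : U) (l : List V) :
    (branchT S (.left b u l)).val =
      (if b then [.inl u] else []) ++ ((keys S.pv).filter (· ∉ l)).map .inr := by
  rw [← keys_filter_fst fun v => decide (v ∉ l)]
  cases b <;> simp [branchT, keys]

theorem branchT_right_val (S : Sets U V) (b : Bool) (v : V) (l : List U) :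
    (branchT S (.right b v l)).val =
      (if b then [.inr v] else []) ++ ((keys S.pu).filter (· ∉ l)).map .inl := by
  rw [← keys_filter_fst fun u => decide (u ∉ l)]
  cases b <;> simp [branchT, keys]

theorem filter_map_time_le {α β γ : Type} [DecidableEq α] {p : ℕ} (f : α → γ) (l : List α)
    (es : List (α × β)) (hl : l.length ≤ p) (b : Bool) (c : γ) :
    (do
      let es' ← filterT (fun e => do
        let b ← memT e.1 l
        op (!b)) es
      let q ← mapT (fun e => op (f e.1)) es'
      if b then op (c :: q) else op q : Timed (List γ)).time ≤ es.length * (p + 5) + 3 := by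
  have h₁ : (filterT (fun e : α × β => do
      let b ← memT e.1 l
      op (!b)) es).time ≤ es.length * (p + 2 + 1) + 1 :=
    filterT_time_le _ _ _ fun e _ => by
      have := memT_time_le e.1 l
      simp only [time_bind, time_op]
      omega
  have h₂ := mapT_time_le (fun e : α × β => op (f e.1)) 1 (filterT (fun e : α × β => do
      let b ← memT e.1 l
      op (!b)) es).val fun _ _ => le_rfl
  have h₃ : (filterT (fun e : α × β => do
      let b ← memT e.1 l
      op (!b)) es).val.length ≤ es.length := by
    rw [filterT_val]; exact List.length_filter_le _ _
  simp only [time_bind, time_ite, time_op, ite_self] at h₁ h₂ h₃ ⊢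
  nlinarith

variable [Fintype U] [Fintype V] {E : Finset (U × V)}

theorem Represents.branchT {S : Sets U V} (h : RepresentsIn E S) {c : ℕ × Pivot U V}
    (hc : c ∈ candidates S) :
    c.2.vertex ∈ S.pset ∪ S.xset ∧ c.1 = (branchSet E S.pset c.2.vertex).card ∧
      (branchT S c.2).val.Nodup ∧ (branchT S c.2).val.toFinset = branchSet E S.pset c.2.vertex ∧
      (branchT S c.2).time ≤ S.cardP * (S.cardP + 5) + 3 := by
  have hU := List.nodup_append'.1 h.nodupU
  have hV := List.nodup_append'.1 h.nodupV
  suffices c.2.vertex ∈ S.pset ∪ S.xset ∧ (BBK.branchT S c.2).val.Nodup ∧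
      (BBK.branchT S c.2).val.toFinset = branchSet E S.pset c.2.vertex ∧
      c.1 = (BBK.branchT S c.2).val.length ∧
      (BBK.branchT S c.2).time ≤ S.cardP * (S.cardP + 5) + 3 by
    obtain ⟨h₁, h₂, h₃, h₄, h₅⟩ := this
    exact ⟨h₁, by rw [h₄, ← h₃, List.toFinset_card_of_nodup h₂], h₂, h₃, h₅⟩
  have timeL : ∀ (b : Bool) (u : U) (l : List V), l.length ≤ S.pv.length →
      (BBK.branchT S (.left b u l)).time ≤ S.cardP * (S.cardP + 5) + 3 := fun b u l hl => by
    refine (filter_map_time_le Sum.inr l S.pv hl b (Sum.inl u)).trans ?_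
    gcongr <;> simp [Sets.cardP]
  have timeR : ∀ (b : Bool) (v : V) (l : List U), l.length ≤ S.pu.length →
      (BBK.branchT S (.right b v l)).time ≤ S.cardP * (S.cardP + 5) + 3 := fun b v l hl => by
    refine (filter_map_time_le Sum.inl l S.pu hl b (Sum.inr v)).trans ?_
    gcongr <;> simp [Sets.cardP]
  simp only [candidates, List.mem_append, List.mem_map] at hc
  rcases hc with ((⟨e, he, rfl⟩ | ⟨e, he, rfl⟩) | ⟨e, he, rfl⟩) | ⟨e, he, rfl⟩
  · have hl := h.pu.length_le e he
    have hn := length_filter_notMem hV.1 (h.pu e he).1 fun b hb => (((h.pu e he).2 b).1 hb).1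
    have hm := mem_keys_of_mem he
    rw [length_keys] at hl hn
    refine ⟨by simp [Pivot.vertex, hm], ?_, ?_, ?_, timeL _ _ _ hl⟩
    · rw [branchT_left_val]
      simpa using (hV.1.filter _).map Sum.inr_injective
    · rw [branchT_left_val]
      ext (w | w)
      · simp [branchSet, Pivot.vertex, hm]
      · simp [branchSet, Pivot.vertex, hm, (h.pu e he).2]
        exact fun a b => absurd a b
    · rw [branchT_left_val]
      simp only [if_true, List.length_append, List.length_map, hn, List.length_singleton]
      omega
  · have hl := h.pv.length_le e he
    have hn := length_filter_notMem hU.1 (h.pv e he).1 fun b hb => (((h.pv e he).2 b).1 hb).1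
    have hm := mem_keys_of_mem he
    rw [length_keys] at hl hn
    refine ⟨by simp [Pivot.vertex, hm], ?_, ?_, ?_, timeR _ _ _ hl⟩
    · rw [branchT_right_val]
      simpa using (hU.1.filter _).map Sum.inl_injective
    · rw [branchT_right_val]
      ext (w | w)
      · simp [branchSet, Pivot.vertex, hm, (h.pv e he).2]
        exact fun a b => absurd a b
      · simp [branchSet, Pivot.vertex, hm]
    · rw [branchT_right_val]
      simp only [if_true, List.length_append, List.length_map, hn, List.length_singleton]
      omega
  · have hl := h.xu.length_le e he
    have hn := length_filter_notMem hV.1 (h.xu e he).1 fun b hb => (((h.xu e he).2 b).1 hb).1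
    have hm := mem_keys_of_mem he
    -- Disjointness of `P` and `X`: a pivot from `X` is not branched on, so its base value has no `+
    -- 1`.
    have hm' : e.1 ∉ keys S.pu := fun h' => hU.2.2 h' hm
    rw [length_keys] at hl hn
    refine ⟨by simp [Pivot.vertex, hm], ?_, ?_, ?_, timeL _ _ _ hl⟩
    · rw [branchT_left_val]
      simpa using (hV.1.filter _).map Sum.inr_injective
    · rw [branchT_left_val]
      ext (w | w)
      · simp [branchSet, Pivot.vertex, hm']
      · simp [branchSet, Pivot.vertex, hm', (h.xu e he).2]
        exact fun a b => absurd a b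
    · rw [branchT_left_val]
      simp only [Bool.false_eq_true, if_false, List.nil_append, List.length_map, hn]
  · have hl := h.xv.length_le e he
    have hn := length_filter_notMem hU.1 (h.xv e he).1 fun b hb => (((h.xv e he).2 b).1 hb).1
    have hm := mem_keys_of_mem he
    have hm' : e.1 ∉ keys S.pv := fun h' => hV.2.2 h' hm
    rw [length_keys] at hl hn
    refine ⟨by simp [Pivot.vertex, hm], ?_, ?_, ?_, timeR _ _ _ hl⟩
    · rw [branchT_right_val]
      simpa using (hU.1.filter _).map Sum.inl_injective
    · rw [branchT_right_val]
      ext (w | w)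
      · simp [branchSet, Pivot.vertex, hm', (h.xv e he).2]
        exact fun a b => absurd a b
      · simp [branchSet, Pivot.vertex, hm']
    · rw [branchT_right_val]
      simp only [Bool.false_eq_true, if_false, List.nil_append, List.length_map, hn]

/-- The pivot minimizes the size of the branching set. -/
theorem Represents.le_of_isMinOf {S : Sets U V} (h : RepresentsIn E S) {b : ℕ × Pivot U V}
    (hb : IsMinOf (some b) (candidates S)) {x : U ⊕ V} (hx : x ∈ S.pset ∪ S.xset) :
    (branchSet E S.pset b.2.vertex).card ≤ (branchSet E S.pset x).card := by
  obtain ⟨c, hc, rfl⟩ : ∃ c ∈ candidates S, c.2.vertex = x := by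
    apply exists_candidate
    rcases x with x | x <;> simpa using hx
  rw [← (h.branchT hb.1).2.1, ← (h.branchT hc).2.1]
  exact hb.2 c hc

end Pivot
-- Correctness and running time of the recursive calls
section Calls

variable {U V : Type} [DecidableEq U] [DecidableEq V]

/-- The number of vertices of `R ∪ P ∪ X`, plus one. -/
def total (R : List (U ⊕ V)) (S : Sets U V) : ℕ := R.length + S.cardP + S.cardX + 1

theorem loopT_cons_val
    (rec : List (U ⊕ V) → Sets U V → List (List (U ⊕ V)) → Timed (List (List (U ⊕ V))))
    (R : List (U ⊕ V)) (x : U ⊕ V) (qs : List (U ⊕ V)) (S : Sets U V)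
    (out : List (List (U ⊕ V))) :
    (loopT rec R (x :: qs) S out).val =
      (loopT rec R qs (moveSets S x) (rec (x :: R) (childSets S x) out).val).val := by
  cases x <;> rfl

/-- The constant is `17 = 8 + 8 + 1`: building the child, moving `x` to `X`, and looking up its
neighbour list. -/
theorem Represents.loopT_cons_time_le {r : U → V → Prop} {S : Sets U V} (h : Represents r S)
    (rec : List (U ⊕ V) → Sets U V → List (List (U ⊕ V)) → Timed (List (List (U ⊕ V))))
    (R : List (U ⊕ V)) {x : U ⊕ V} (hx : x ∈ S.pset) (qs : List (U ⊕ V))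
    (out : List (List (U ⊕ V))) :
    (loopT rec R (x :: qs) S out).time ≤
      (rec (x :: R) (BBK.childSets S x) out).time + total R S * (17 * (S.cardP + 1) ^ 2) +
      (loopT rec R qs (BBK.moveSets S x) (rec (x :: R) (BBK.childSets S x) out).val).time := by
  have hU : (keys S.pu).length ≤ S.cardP := by simp [Sets.cardP]
  have hV : (keys S.pv).length ≤ S.cardP := by simp [Sets.cardP]
  have pu := fun e he => (h.pu.length_le e he).trans hV
  have pv := fun e he => (h.pv.length_le e he).trans hU
  have xu := fun e he => (h.xu.length_le e he).trans hV
  have xv := fun e he => (h.xv.length_le e he).trans hU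
  have hs : S.cardP + S.cardX + 1 ≤ total R S := by simp only [total]; omega
  have hw : 0 < (S.cardP + 1) ^ 2 := by positivity
  have htot : total R S * (17 * (S.cardP + 1) ^ 2) = total R S * (8 * (S.cardP + 1) ^ 2) +
    total R S * (8 * (S.cardP + 1) ^ 2) + total R S * (S.cardP + 1) ^ 2 := by ring
  have h₀ : total R S ≤ total R S * (S.cardP + 1) ^ 2 := Nat.le_mul_of_pos_right _ hw
  have h₁ := Nat.mul_le_mul_right (8 * (S.cardP + 1) ^ 2) hs
  cases x with
  | inl u =>
    have hm := lookupT_mem (inl_mem_pset.1 hx)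
    have h₂ := lookupT_time_le u S.pu
    have h₃ := childT_time_le u (lookupT u S.pu).val S (pu _ hm) pu pv xu xv
    have h₄ := moveT_time_le u (lookupT u S.pu).val S pv xv
    simp only [loopT, time_bind, BBK.childSets, BBK.moveSets]
    rw [length_keys] at hU
    omega
  | inr v =>
    have hm := lookupT_mem (inr_mem_pset.1 hx)
    have h₂ := lookupT_time_le v S.pv
    have h₃ := childT_time_le v (lookupT v S.pv).val S.swap (pv _ hm) pv pu xv xu
    have h₄ := moveT_time_le v (lookupT v S.pv).val S.swap pu xu
    have e₁ : S.swap.cardP = S.cardP := Nat.add_comm _ _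
    have e₂ : S.swap.cardX = S.cardX := Nat.add_comm _ _
    rw [e₁, e₂] at h₃ h₄
    clear e₁ e₂
    simp only [loopT, time_bind, BBK.childSets, BBK.moveSets]
    rw [length_keys] at hV
    omega

variable [Fintype U] [Fintype V] {E : Finset (U × V)}

/-- The loop carries out the pseudocode, and its running time is bounded by that of the calls. -/
theorem loopT_spec
    {rec : List (U ⊕ V) → Sets U V → List (List (U ⊕ V)) → Timed (List (List (U ⊕ V)))}
    {m p s : ℕ} {T : ℝ}
    (hrec : ∀ R S out, RepresentsIn E S → S.cardP ≤ m → S.cardP < p → total R S ≤ s →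
      Call E R.toFinset S.pset S.xset (out.map List.toFinset)
        ((rec R S out).val.map List.toFinset) ∧ ((rec R S out).time : ℝ) ≤ T)
    (R : List (U ⊕ V)) (qs : List (U ⊕ V)) :
    ∀ (S : Sets U V) (out : List (List (U ⊕ V))), RepresentsIn E S → qs.Nodup →
      (∀ x ∈ qs, x ∈ S.pset) → (∀ x ∈ qs, (childP E S.pset x).card ≤ m) →
      S.cardP ≤ p → total R S ≤ s →
      Loop E R.toFinset S.pset S.xset qs (out.map List.toFinset)
        ((loopT rec R qs S out).val.map List.toFinset) ∧
      ((loopT rec R qs S out).time : ℝ) ≤ qs.length * (T + s * (17 * (p + 1) ^ 2)) + 1 := by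
  induction qs with
  | nil =>
    intro S out h _ _ _ _ _
    exact ⟨Loop.nil _ _ _ _, by simp [loopT]⟩
  | cons x qs ih =>
    intro S out h hqs hmem hm hp hs
    have hx := hmem x (by simp)
    have hchild := h.childSets hx
    have hmove := h.moveSets hx
    have cp : (childSets S x).cardP = (childP E S.pset x).card := by
      rw [← hchild.card_pset, pset_childSets h hx]
    have cx : (childSets S x).cardX ≤ S.cardX := by
      rw [← hchild.card_xset, xset_childSets h hx, ← h.card_xset]
      exact Finset.card_le_card (childX_subset _ _)
    have clt : (childP E S.pset x).card < S.cardP := by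
      rw [← h.card_pset]
      exact Finset.card_lt_card ⟨childP_subset _ _, fun h' => notMem_childP _ _ (h' hx)⟩
    have mp : (moveSets S x).cardP = S.cardP - 1 := by
      rw [← hmove.card_pset, pset_moveSets, ← h.card_pset, Finset.sdiff_singleton_eq_erase,
        Finset.card_erase_of_mem hx]
    have mx : (moveSets S x).cardX ≤ S.cardX + 1 := by
      rw [← hmove.card_xset, xset_moveSets, ← h.card_xset]
      exact (Finset.card_union_le _ _).trans (by simp)
    have hs' : R.length + S.cardP + S.cardX + 1 ≤ s := hs
    -- The total does not grow: `x` enters `R` but leaves `P`, and `X_x ⊆ X`. In the remaining loop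
    -- `x` merely changes from `P` to `X`.
    obtain ⟨c₁, t₁⟩ := hrec (x :: R) (childSets S x) out hchild (cp ▸ hm x (by simp)) (by omega)
      (by simp only [total, List.length_cons]; omega)
    obtain ⟨c₂, t₂⟩ := ih (moveSets S x) (rec (x :: R) (childSets S x) out).val hmove
      (List.nodup_cons.1 hqs).2
      (fun y hy => by
        rw [pset_moveSets]
        exact Finset.mem_sdiff.2 ⟨hmem y (by simp [hy]), fun h' =>
          (List.nodup_cons.1 hqs).1 (Finset.mem_singleton.1 h' ▸ hy)⟩)
      (fun y hy => by
        rw [pset_moveSets]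
        exact (Finset.card_le_card (childP_mono Finset.sdiff_subset _)).trans (hm y (by simp [hy])))
      (by omega) (by simp only [total]; omega)
    constructor
    · rw [loopT_cons_val]
      refine Loop.cons _ _ _ _ _ _ ((rec (x :: R) (childSets S x) out).val.map List.toFinset) _ ?_ ?_
      · rw [← pset_childSets h hx, ← xset_childSets h hx]
        rw [List.toFinset_cons, Finset.insert_eq, Finset.union_comm] at c₁
        exact c₁
      · rw [← pset_moveSets, ← xset_moveSets]
        exact c₂
    · have h₁ : ((loopT rec R (x :: qs) S out).time : ℝ) ≤ _ :=
        Nat.cast_le.2 (h.loopT_cons_time_le rec R hx qs out)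
      have h₂ : (total R S * (17 * (S.cardP + 1) ^ 2) : ℝ) ≤ s * (17 * (p + 1) ^ 2) := by
        gcongr
      rw [List.length_cons]
      push_cast at h₁ ⊢
      linarith

/-- Conditions on `F` under which the running time for `|P| = p` is bounded by a multiple of
`F p`. -/
structure IsBranchBound (F : ℕ → ℝ) : Prop where
  mono : Monotone F
  branch : ∀ p k : ℕ, k ≤ p → ((p : ℝ) + 1) ^ 3 + k * F (p - k) ≤ F p

theorem IsBranchBound.pow_le {F : ℕ → ℝ} (h : IsBranchBound F) (p : ℕ) :
    ((p : ℝ) + 1) ^ 3 ≤ F p := by simpa using h.branch p 0 p.zero_le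

/-- The recursive function carries out the pseudocode in the time allowed by a branch bound. -/
theorem callT_spec {F : ℕ → ℝ} (hF : IsBranchBound F) (n : ℕ) :
    ∀ (R : List (U ⊕ V)) (S : Sets U V) (out : List (List (U ⊕ V))), RepresentsIn E S →
      S.cardP < n →
      Call E R.toFinset S.pset S.xset (out.map List.toFinset)
        ((callT n R S out).val.map List.toFinset) ∧
      ((callT n R S out).time : ℝ) ≤ 34 * total R S * F S.cardP := by
  induction n with
  | zero => intro _ _ _ _ h; omega
  | succ n ih =>
    intro R S out h hn
    have hF₁ := hF.pow_le S.cardP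
    have hpos : (1 : ℝ) ≤ ((S.cardP : ℝ) + 1) ^ 3 := one_le_pow₀ (by simp)
    have htot : (1 : ℝ) ≤ total R S := by simp [total]; positivity
    have htF : (total R S : ℝ) ≤ total R S * F S.cardP :=
      le_mul_of_one_le_right (by positivity) (hpos.trans hF₁)
    have hc₁ := reportTest_iff (S := S)
    have hc₂ := stopTest_iff (S := S)
    by_cases c₁ : ((S.pu.isEmpty || S.pv.isEmpty) && (S.xu.isEmpty && S.xv.isEmpty)) = true
    · constructor
      · have hval : ((callT (n + 1) R S out).val.map List.toFinset) =
            (R.toFinset ∪ S.pset) :: out.map List.toFinset := by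
          simp only [callT, val_bind, val_op, c₁, if_true, List.map_cons, reportT, mapT_val,
            appendT_val]
          congr 1
          ext (w | w) <;> simp [keys]
        rw [hval]
        exact Call.report _ _ _ _ (hc₁.2 c₁)
      · have h₁ := mapT_time_le (fun e : U × List V => op (Sum.inl e.1 : U ⊕ V)) 1 S.pu
          fun _ _ => le_rfl
        have h₂ := mapT_time_le (fun e : V × List U => op (Sum.inr e.1 : U ⊕ V)) 1 S.pv
          fun _ _ => le_rfl
        have h₃ : (callT (n + 1) R S out).time ≤ 8 * total R S := by
          simp only [callT, time_bind, time_op, val_op, c₁, if_true, reportT, appendT_time,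
            mapT_val, List.length_map, total, Sets.cardP] at h₁ h₂ ⊢
          omega
        have h₄ : ((callT (n + 1) R S out).time : ℝ) ≤ 8 * total R S := by exact_mod_cast h₃
        nlinarith
    by_cases c₂ : ((S.pu.isEmpty && !S.xv.isEmpty) || (S.pv.isEmpty && !S.xu.isEmpty)) = true
    · constructor
      · have hval : (callT (n + 1) R S out).val = out := by
          simp only [callT, val_bind, val_op, c₁, c₂, if_true, Bool.false_eq_true, if_false]
        rw [hval]
        exact Call.giveUp _ _ _ _ (mt hc₁.1 c₁) (hc₂.2 c₂)
      · have h₃ : (callT (n + 1) R S out).time = 3 := by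
          simp only [callT, time_bind, time_op, val_op, c₁, c₂, if_true, Bool.false_eq_true, if_false]
        rw [h₃]
        push_cast
        nlinarith
    have hmin := pivotT_isMinOf S
    rcases hb : (pivotT S).val with _ | b
    · rw [hb] at hmin
      exfalso
      -- Without a candidate both `P` and `X` are empty, and the report test would have succeeded.
      have hmin : candidates S = [] := hmin
      simp only [candidates, List.append_eq_nil_iff, List.map_eq_nil_iff] at hmin
      obtain ⟨⟨⟨h₁, h₂⟩, h₃⟩, h₄⟩ := hmin
      exact c₁ (by simp [h₁, h₃, h₄])
    · rw [hb] at hmin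
      obtain ⟨b₁, b₂, b₃, b₄, b₅⟩ := h.branchT hmin.1
      have hval : (callT (n + 1) R S out).val =
          (loopT (callT n) R (branchT S b.2).val S out).val := by
        simp only [callT, val_bind, val_op, c₁, c₂, Bool.false_eq_true, if_false, hb]
      have htime : (callT (n + 1) R S out).time =
          2 + (pivotT S).time + (branchT S b.2).time +
          (loopT (callT n) R (branchT S b.2).val S out).time := by
        simp only [callT, time_bind, time_op, val_op, c₁, c₂, Bool.false_eq_true, if_false, hb]
        ring
      set qs := (branchT S b.2).val with hqs
      have hlen : qs.length = (branchSet E S.pset b.2.vertex).card := by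
        rw [← b₄, List.toFinset_card_of_nodup b₃]
      have hk : qs.length ≤ S.cardP := by
        rw [hlen, ← h.card_pset]
        exact Finset.card_le_card (branchSet_subset _ _)
      have hmem : ∀ x ∈ qs, x ∈ S.pset := fun x hx =>
        branchSet_subset (E := E) _ _ (b₄ ▸ List.mem_toFinset.2 hx)
      -- Each `x ∈ Q` lies in `P`, hence competed as a pivot; minimality gives `|Q| ≤ |Q(x)|`, and
      -- `|Q(x)|` is what the child loses.
      have hchild : ∀ x ∈ qs, (childP E S.pset x).card ≤ S.cardP - qs.length := fun x hx => by
        have h₁ := card_childP_add (E := E) (hmem x hx)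
        have h₂ := h.le_of_isMinOf hmin (Finset.mem_union_left S.xset (hmem x hx))
        rw [h.card_pset] at h₁
        omega
      obtain ⟨l₁, l₂⟩ := loopT_spec (rec := callT n) (m := S.cardP - qs.length)
        (T := 34 * total R S * F (S.cardP - qs.length))
        (fun R' S' out' h' hm' hp' hs' => ⟨(ih R' S' out' h' (by omega)).1, by
          refine (ih R' S' out' h' (by omega)).2.trans ?_
          have h₁ := hF.mono hm'
          have h₂ := hF.pow_le S'.cardP
          have h₃ : (0 : ℝ) ≤ F S'.cardP := le_trans (by positivity) h₂
          gcongr⟩)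
        R qs S out h b₃ hmem hchild le_rfl le_rfl
      constructor
      · rw [hval]
        exact Call.branch _ _ _ _ _ _ qs (mt hc₁.1 c₁) (mt hc₂.1 c₂) b₁
          (fun x hx => h.le_of_isMinOf hmin hx) b₃ b₄ l₁
      · have hpt := h.pivotT_time_le
        have hs : S.cardP + S.cardX + 1 ≤ total R S := by simp only [total]; omega
        -- Here `17 = 8 + 9`: the pivot search, then the computation of `Q` with the constant
        -- overhead. Having the same constant as one loop round lets this count as an extra round.
        have hlocal : 2 + (pivotT S).time + (branchT S b.2).time + 1 ≤
            total R S * (17 * (S.cardP + 1) ^ 2) := by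
          have h₁ := Nat.mul_le_mul_right (8 * (S.cardP + 1) ^ 2) hs
          have h₂ : S.cardP * (S.cardP + 5) + 6 ≤ 1 * (9 * (S.cardP + 1) ^ 2) := by nlinarith
          have h₃ : 1 * (9 * (S.cardP + 1) ^ 2) ≤ total R S * (9 * (S.cardP + 1) ^ 2) := by
            gcongr; simp [total]
          linarith
        have hlocal' : (2 + (pivotT S).time + (branchT S b.2).time + 1 : ℝ) ≤
            total R S * (17 * ((S.cardP : ℝ) + 1) ^ 2) := by exact_mod_cast hlocal
        have hbr := hF.branch S.cardP qs.length hk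
        have hkr : (qs.length : ℝ) ≤ S.cardP := by exact_mod_cast hk
        rw [htime]
        push_cast
        -- With `k ≤ p`, the `k` rounds and the extra one cost at most `17 (p + 1)³` per unit of the
        -- total, which the `34 (p + 1)³` from the branch bound covers.
        have hW : (qs.length : ℝ) * (total R S * (17 * ((S.cardP : ℝ) + 1) ^ 2)) ≤
            S.cardP * (total R S * (17 * ((S.cardP : ℝ) + 1) ^ 2)) := by gcongr
        have hmul := mul_le_mul_of_nonneg_left hbr (show (0 : ℝ) ≤ 34 * total R S by positivity)
        have hcube : (0 : ℝ) ≤ total R S * ((S.cardP : ℝ) + 1) ^ 3 := by positivity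
        nlinarith

end Calls
/-! ### The bidegeneracy order -/

section Graph

variable {U V : Type} [Fintype V] [DecidableEq U] [DecidableEq V]

/-- The neighbours of `u` in `V`. -/
def nbrs (E : Finset (U × V)) (u : U) : Finset V := Finset.univ.filter fun v => (u, v) ∈ E

@[simp] theorem mem_nbrs {E : Finset (U × V)} {u : U} {v : V} : v ∈ nbrs E u ↔ (u, v) ∈ E := by
  simp [nbrs]

variable [Fintype U]

/-- The other vertices of `U` that have a common neighbour with `u`. -/
def sharing (E : Finset (U × V)) (u : U) : Finset U :=
  Finset.univ.filter fun w => w ≠ u ∧ ∃ v, (u, v) ∈ E ∧ (w, v) ∈ E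

variable {E : Finset (U × V)}

theorem mem_sharing {u w : U} :
    w ∈ sharing E u ↔ w ≠ u ∧ ∃ v, (u, v) ∈ E ∧ (w, v) ∈ E := by simp [sharing]

theorem mem_sharing_comm {u w : U} : w ∈ sharing E u ↔ u ∈ sharing E w := by
  simp only [mem_sharing, ne_comm (a := w), and_comm (a := (u, _) ∈ E)]

theorem inl_mem_projNbr {u w : U} : Sum.inl w ∈ projNbr E u ↔ w ∈ sharing E u := by
  simp [projNbr, nbr2, mem_sharing]

theorem inr_mem_projNbr {u : U} {v : V} : Sum.inr v ∈ projNbr E u ↔ (u, v) ∈ E := by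
  simp [projNbr, nbr2]

theorem projNbr_sdiff (u : U) (prev : Finset U) :
    projNbr E u \ ofU prev = (sharing E u \ prev).disjSum (nbrs E u) := by
  ext (w | w) <;> simp [ofU, inl_mem_projNbr, inr_mem_projNbr]

/-- At top level `X` has no vertices of `V`, so its size is a count of earlier sharing vertices. -/
theorem projNbr_inter (u : U) (prev : Finset U) :
    projNbr E u ∩ ofU prev = (sharing E u ∩ prev).disjSum ∅ := by
  ext (w | w) <;> simp [ofU, inl_mem_projNbr]

theorem card_projNbr_sdiff (u : U) (prev : Finset U) :
    (projNbr E u \ ofU prev).card = (sharing E u \ prev).card + (nbrs E u).card := by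
  rw [projNbr_sdiff, Finset.card_disjSum]

/-- Sharing a neighbour is symmetric, so after selecting `u` it is enough to decrement the counters
of `N₂(u)`. -/
theorem card_projNbr_sdiff_insert {u w : U} {prev : Finset U} (hu : u ∉ prev) :
    (projNbr E w \ ofU (insert u prev)).card =
      if w ∈ sharing E u then (projNbr E w \ ofU prev).card - 1
      else (projNbr E w \ ofU prev).card := by
  rw [card_projNbr_sdiff, card_projNbr_sdiff, Finset.sdiff_insert]
  split_ifs with h
  · have h' : u ∈ sharing E w \ prev := Finset.mem_sdiff.2 ⟨mem_sharing_comm.1 h, hu⟩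
    have := Finset.card_pos.2 ⟨u, h'⟩
    rw [Finset.card_erase_of_mem h']
    omega
  · rw [Finset.erase_eq_of_notMem]
    exact fun h' => h (mem_sharing_comm.1 (Finset.mem_sdiff.1 h').1)

/-- The supremum is over a set bounded by `|Nᴾ(u)|`, so every witness `W` counts. All later lower
bounds on the bidegeneracy come from a choice of `W`. -/
theorem le_bidegU {c : ℕ} {W : Finset U} {u : U} (hu : u ∈ W)
    (h : ∀ x ∈ W, c ≤ (projNbr E x ∩ (ofU W ∪ allV)).card) : c ≤ bidegU E := by
  refine le_trans ?_ (Finset.le_sup (f := bideg E) (Finset.mem_univ u))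
  refine le_csSup ⟨(projNbr E u).card, ?_⟩ ⟨W, hu, h⟩
  rintro b ⟨W', hu', h'⟩
  exact (h' u hu').trans (Finset.card_le_card Finset.inter_subset_left)

/-- The witness is `{u}`, as all of `V` is retained. -/
theorem card_nbrs_le (E : Finset (U × V)) (u : U) : (nbrs E u).card ≤ bidegU E := by
  refine le_bidegU (Finset.mem_singleton_self u) fun x hx => ?_
  rw [Finset.mem_singleton.1 hx, ← Finset.card_image_of_injective _ (Sum.inr_injective (α := U))]
  refine Finset.card_le_card fun w hw => ?_
  obtain ⟨v, hv, rfl⟩ := Finset.mem_image.1 hw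
  simpa [inr_mem_projNbr, allV] using hv

/-- The witness is `N(v)`: each of its members sees all the others through `v`, and `v` itself makes
up for the member not seeing itself. -/
theorem card_filter_mem_le (E : Finset (U × V)) (v : V) :
    (Finset.univ.filter fun u => (u, v) ∈ E).card ≤ bidegU E := by
  rcases (Finset.univ.filter fun u => (u, v) ∈ E).eq_empty_or_nonempty with h | ⟨u, hu⟩
  · simp [h]
  refine le_bidegU hu fun x hx => ?_
  have hxv : (x, v) ∈ E := by simpa using hx
  calc _ = (insert (Sum.inr v : U ⊕ V)
          (((Finset.univ.filter fun u => (u, v) ∈ E).erase x).image Sum.inl)).card := by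
        rw [Finset.card_insert_of_notMem (by simp),
          Finset.card_image_of_injective _ Sum.inl_injective, Finset.card_erase_add_one hx]
    _ ≤ _ := by
        refine Finset.card_le_card fun w hw => ?_
        rcases w with w | w
        · simp only [Finset.mem_insert, reduceCtorEq, Finset.mem_image, Finset.mem_erase,
            Finset.mem_filter, Finset.mem_univ, true_and, Sum.inl.injEq, exists_eq_right,
            false_or] at hw
          simp only [Finset.mem_inter, inl_mem_projNbr, mem_sharing]
          exact ⟨⟨hw.1, v, hxv, hw.2⟩, by simp [ofU, hw.2]⟩
        · obtain rfl : w = v := by simpa using hw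
          simpa [inr_mem_projNbr, allV] using hxv

/-- In an enumeration of the remaining vertices in which each minimizes `|Nᴾ(w) \ prev|`, this
number is at most the bidegeneracy. -/
theorem card_projNbr_sdiff_le {u : U} {prev : Finset U} (hu : u ∉ prev)
    (h : ∀ w ∉ prev, (projNbr E u \ ofU prev).card ≤ (projNbr E w \ ofU prev).card) :
    (projNbr E u \ ofU prev).card ≤ bidegU E := by
  -- For `W = U \ prev`, intersecting with `W ∪ V` is the same as removing `prev`.
  refine le_bidegU (W := prevᶜ) (u := u) (by simpa using hu) fun x hx => ?_
  refine (h x (by simpa using hx)).trans (Finset.card_le_card fun w hw => ?_)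
  rcases w with w | w <;> simpa [ofU, allV] using hw

/-- Every vertex minimizes `|Nᴾ(w) \ prev|` among the remaining ones. -/
def OrderFrom (E : Finset (U × V)) : Finset U → List U → Prop
  | _, [] => True
  | prev, u :: us => (∀ w ∈ u :: us,
      (projNbr E u \ ofU prev).card ≤ (projNbr E w \ ofU prev).card) ∧
      OrderFrom E (insert u prev) us

theorem OrderFrom.minimal {pre rest : List U} {u : U} : ∀ {prev : Finset U},
    OrderFrom E prev (pre ++ u :: rest) → ∀ w ∈ u :: rest,
      (projNbr E u \ ofU (prev ∪ pre.toFinset)).card ≤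
        (projNbr E w \ ofU (prev ∪ pre.toFinset)).card := by
  induction pre with
  | nil => intro prev h w hw; simpa using h.1 w hw
  | cons a pre ih =>
    intro prev h w hw
    have := ih h.2 w hw
    rwa [Finset.insert_union, ← Finset.union_insert, ← List.toFinset_cons] at this

end Graph

-- The bucket queue and its amortized cost

section Order

variable {U V : Type}

@[simp] theorem alloc_val {ι α : Type} (n : ℕ) (a : α) :
    (alloc n a : Timed (ι → α)).val = fun _ => a := rfl

@[simp] theorem alloc_time {ι α : Type} (n : ℕ) (a : α) :
    (alloc n a : Timed (ι → α)).time = n + 1 := rfl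

/-- The total length of the first `M` buckets. -/
def bucketSize (M : ℕ) (B : ℕ → List U) : ℕ := ∑ k ∈ Finset.range M, (B k).length

theorem bucketSize_update {M k : ℕ} (hk : k < M) (B : ℕ → List U) (l : List U) :
    bucketSize M (Function.update B k l) + (B k).length = bucketSize M B + l.length := by
  have hk' := Finset.mem_range.2 hk
  unfold bucketSize
  rw [← Finset.add_sum_erase _ _ hk', ← Finset.add_sum_erase _ (fun k => (B k).length) hk',
    Function.update_self, Finset.sum_congr rfl fun j hj => by
      rw [Function.update_of_ne (Finset.ne_of_mem_erase hj)]]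
  ring

theorem bucketSize_update_cons_le (M k : ℕ) (B : ℕ → List U) (u : U) :
    bucketSize M (Function.update B k (u :: B k)) ≤ bucketSize M B + 1 := by
  by_cases hk : k < M
  · have := bucketSize_update hk B (u :: B k)
    rw [List.length_cons] at this
    omega
  · refine le_trans (le_of_eq (Finset.sum_congr rfl fun j hj => ?_)) (Nat.le_succ _)
    rw [Function.update_of_ne]
    have := Finset.mem_range.1 hj
    omega

theorem subset_update_cons (B : ℕ → List U) (k : ℕ) (u : U) (j : ℕ) :
    B j ⊆ Function.update B k (u :: B k) j := by
  by_cases h : j = k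
  · subst h; simp
  · simp [h]

theorem fillT_spec (cnt : U → ℕ) (M : ℕ) (us : List U) : ∀ B : ℕ → List U,
    (∀ u ∈ us, u ∈ (fillT cnt us B).val (cnt u)) ∧ (∀ k, B k ⊆ (fillT cnt us B).val k) ∧
      bucketSize M (fillT cnt us B).val ≤ bucketSize M B + us.length ∧
      (fillT cnt us B).time = 3 * us.length + 1 := by
  induction us with
  | nil => intro B; simp [fillT]
  | cons u us ih =>
    intro B
    simp only [fillT, val_bind, val_op, time_bind, time_op]
    obtain ⟨h₁, h₂, h₃, h₄⟩ := ih (Function.update B (cnt u) (u :: B (cnt u)))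
    refine ⟨fun w hw => ?_, fun k => List.Subset.trans (subset_update_cons B _ u k) (h₂ k), ?_, ?_⟩
    · rcases List.mem_cons.1 hw with rfl | hw
      · exact h₂ _ (by simp)
      · exact h₁ w hw
    · have := bucketSize_update_cons_le M (cnt u) B u
      rw [List.length_cons]
      omega
    · rw [h₄, List.length_cons]
      ring

theorem purgeT_cons_val (cnt : U → ℕ) (sel : U → Bool) (k : ℕ) (u : U) (l : List U) :
    (purgeT cnt sel k (u :: l)).val =
      if (sel u || decide (cnt u ≠ k)) = true then (purgeT cnt sel k l).val else u :: l :=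
  apply_ite Timed.val _ _ _

theorem purgeT_cons_time (cnt : U → ℕ) (sel : U → Bool) (k : ℕ) (u : U) (l : List U) :
    (purgeT cnt sel k (u :: l)).time =
      1 + (1 + (1 + if (sel u || decide (cnt u ≠ k)) = true then (purgeT cnt sel k l).time else 1)) :=
  congrArg (fun n => 1 + (1 + (1 + n))) (apply_ite Timed.time _ _ _)

theorem purgeT_val (cnt : U → ℕ) (sel : U → Bool) (k : ℕ) (l : List U) :
    (purgeT cnt sel k l).val = l.dropWhile fun u => sel u || decide (cnt u ≠ k) := by
  induction l with
  | nil => rfl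
  | cons u l ih => rw [purgeT_cons_val, ih, List.dropWhile_cons]

/-- Each discarded entry accounts for three steps, so three times the length of the list serves as
potential. -/
theorem purgeT_time_le (cnt : U → ℕ) (sel : U → Bool) (k : ℕ) (l : List U) :
    (purgeT cnt sel k l).time + 3 * (purgeT cnt sel k l).val.length ≤ 3 * l.length + 4 := by
  induction l with
  | nil => simp [purgeT]
  | cons u l ih =>
    rw [purgeT_cons_val, purgeT_cons_time]
    split_ifs <;> rw [List.length_cons] <;> omega

theorem mem_purgeT {cnt : U → ℕ} {sel : U → Bool} {k : ℕ} {l : List U} {u : U} (hu : u ∈ l)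
    (hs : sel u = false) (hc : cnt u = k) : u ∈ (purgeT cnt sel k l).val := by
  rw [purgeT_val]
  rw [← List.takeWhile_append_dropWhile (p := fun u => sel u || decide (cnt u ≠ k)) (l := l),
    List.mem_append] at hu
  refine hu.resolve_left fun h => ?_
  have := List.mem_takeWhile_imp h
  simp [hs, hc] at this

/-- A vertex with smallest counter is found, and scanning is paid for by the discarded entries. -/
theorem findMinT_spec (cnt : U → ℕ) (sel : U → Bool) {M : ℕ} (n : ℕ) :
    ∀ (k : ℕ) (B : ℕ → List U), k + n ≤ M →
      (∀ u, sel u = false → u ∈ B (cnt u) ∧ k ≤ cnt u) →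
      (∃ u, sel u = false ∧ cnt u < k + n) →
      ∃ u B', (findMinT cnt sel n k B).val = some (u, B') ∧ sel u = false ∧
        (∀ w, sel w = false → cnt u ≤ cnt w) ∧
        (∀ w, sel w = false → w ≠ u → w ∈ B' (cnt w)) ∧
        (findMinT cnt sel n k B).time + 3 * bucketSize M B' ≤ 3 * bucketSize M B + 6 * n := by
  induction n with
  | zero =>
    rintro k B _ h ⟨u, hu, hlt⟩
    have := (h u hu).2
    omega
  | succ n ih =>
    intro k B hM h hex
    have hp := purgeT_time_le cnt sel k (B k)
    rcases hl : (purgeT cnt sel k (B k)).val with _ | ⟨u, r⟩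
    -- Purging removes only stale entries. If nothing is left, no unselected vertex has counter `k`,
    -- so the search may go on at `k + 1`.
    · have hk : ∀ u, sel u = false → k + 1 ≤ cnt u := fun u hu => by
        rcases (h u hu).2.lt_or_eq with h' | h'
        · exact h'
        · have := mem_purgeT (h' ▸ (h u hu).1) hu h'.symm
          rw [hl] at this
          simp at this
      obtain ⟨u, B', h₁, h₂, h₃, h₄, h₅⟩ := ih (k + 1) (Function.update B k []) (by omega)
        (fun u hu => ⟨by
          rw [Function.update_of_ne (by have := hk u hu; omega)]
          exact (h u hu).1, hk u hu⟩)
        (by obtain ⟨u, hu, hlt⟩ := hex; exact ⟨u, hu, by omega⟩)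
      refine ⟨u, B', ?_, h₂, h₃, h₄, ?_⟩
      · simp only [findMinT, val_bind, val_op, hl, h₁]
      -- An emptied bucket costs six steps beyond its discarded entries: one read, at most four from
      -- purging, one write.
      · have := bucketSize_update (show k < M by omega) B []
        simp only [findMinT, time_bind, val_op, time_op, hl, List.length_nil] at hp this ⊢
        omega
    · have hu : sel u = false ∧ cnt u = k := by
        have h₁ := List.head?_dropWhile_not (fun u => sel u || decide (cnt u ≠ k)) (B k)
        rw [← purgeT_val, hl] at h₁
        simpa using h₁
      refine ⟨u, Function.update B k r, ?_, hu.1, fun w hw => hu.2 ▸ (h w hw).2, ?_, ?_⟩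
      · simp only [findMinT, val_bind, val_op, hl]
      · intro w hw hwu
        by_cases hc : cnt w = k
        · rw [hc, Function.update_self]
          have := mem_purgeT (hc ▸ (h w hw).1) hw hc
          rw [hl] at this
          exact (List.mem_cons.1 this).resolve_left hwu
        · rw [Function.update_of_ne hc]
          exact (h w hw).1
      · have := bucketSize_update (show k < M by omega) B r
        simp only [findMinT, time_bind, val_op, time_op, hl, List.length_cons] at hp this ⊢
        omega

variable [DecidableEq U]

theorem addNewT_nodup (u : U) (ws : List U) : ∀ acc : List U, acc.Nodup →
    (addNewT u ws acc).val.Nodup := by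
  induction ws with
  | nil => intro acc h; simpa [addNewT] using h
  | cons w ws ih =>
    intro acc h
    by_cases h₁ : w = u
    · simpa [addNewT, h₁] using ih acc h
    by_cases h₂ : w ∈ acc
    · simpa [addNewT, h₁, h₂] using ih acc h
    · simpa [addNewT, h₁, h₂] using ih (w :: acc) (List.nodup_cons.2 ⟨h₂, h⟩)

theorem mem_addNewT (u : U) (ws : List U) {x : U} : ∀ acc : List U,
    x ∈ (addNewT u ws acc).val ↔ x ∈ acc ∨ (x ≠ u ∧ x ∈ ws) := by
  induction ws with
  | nil => intro acc; simp [addNewT]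
  | cons w ws ih =>
    intro acc
    by_cases h₁ : w = u
    · simp only [addNewT, val_bind, val_op, h₁, decide_true, if_true, ih, List.mem_cons]
      tauto
    by_cases h₂ : w ∈ acc
    · simp only [addNewT, val_bind, val_op, h₁, decide_false, Bool.false_eq_true, if_false,
        memT_val, h₂, decide_true, if_true, ih, List.mem_cons]
      by_cases hx : x = w
      · subst hx; simp [h₂]
      · simp [hx]
    · simp only [addNewT, val_bind, val_op, h₁, decide_false, Bool.false_eq_true, if_false,
        memT_val, h₂, ih, List.mem_cons]
      by_cases hx : x = w
      · subst hx; simp [h₁]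
      · simp [hx]

theorem addNewT_length_le (u : U) (ws : List U) : ∀ acc : List U,
    (addNewT u ws acc).val.length ≤ acc.length + ws.length := by
  induction ws with
  | nil => intro acc; simp [addNewT]
  | cons w ws ih =>
    intro acc
    have ih₁ := ih acc
    have ih₂ := ih (w :: acc)
    rw [List.length_cons] at ih₂ ⊢
    by_cases h₁ : w = u
    · simp [addNewT, h₁]
      omega
    by_cases h₂ : w ∈ acc
    · simp [addNewT, h₁, h₂]
      omega
    · simp [addNewT, h₁, h₂]
      omega

theorem addNewT_time_le (u : U) (ws : List U) {M : ℕ} : ∀ acc : List U,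
    acc.length + ws.length ≤ M → (addNewT u ws acc).time ≤ ws.length * (M + 2) + 1 := by
  induction ws with
  | nil => intro acc _; simp [addNewT]
  | cons w ws ih =>
    intro acc hM
    rw [List.length_cons] at hM
    have ih₁ := ih acc (by omega)
    have ih₂ := ih (w :: acc) (by rw [List.length_cons]; omega)
    have h₃ := memT_time_le w acc
    have e : (w :: ws).length * (M + 2) = ws.length * (M + 2) + (M + 2) := by
      rw [List.length_cons]; ring
    rw [e]
    by_cases h₁ : w = u
    · simp [addNewT, h₁]
      omega
    by_cases h₂ : w ∈ acc
    · simp [addNewT, h₁, h₂]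
      omega
    · simp [addNewT, h₁, h₂]
      omega

variable {E : Finset (U × V)}

theorem nbr2T_nodup (A : AdjLists E) (u : U) (vs : List V) : ∀ acc : List U, acc.Nodup →
    (nbr2T A u vs acc).val.Nodup := by
  induction vs with
  | nil => intro acc h; simpa [nbr2T] using h
  | cons v vs ih => intro acc h; simpa [nbr2T] using ih _ (addNewT_nodup u _ _ h)

theorem mem_nbr2T (A : AdjLists E) (u : U) (vs : List V) {x : U} : ∀ acc : List U,
    x ∈ (nbr2T A u vs acc).val ↔ x ∈ acc ∨ (x ≠ u ∧ ∃ v ∈ vs, (x, v) ∈ E) := by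
  induction vs with
  | nil => intro acc; simp [nbr2T]
  | cons v vs ih =>
    intro acc
    simp only [nbr2T, val_bind, val_op, ih, mem_addNewT, A.mem_nbrV, List.mem_cons,
      exists_eq_or_imp]
    tauto

theorem nbr2T_length_le (A : AdjLists E) (u : U) (vs : List V) {b : ℕ}
    (hb : ∀ v, (A.nbrV v).length ≤ b) : ∀ acc : List U,
    (nbr2T A u vs acc).val.length ≤ acc.length + vs.length * b := by
  induction vs with
  | nil => intro acc; simp [nbr2T]
  | cons v vs ih =>
    intro acc
    have h₁ := ih (addNewT u (A.nbrV v) acc).val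
    have h₂ := addNewT_length_le u (A.nbrV v) acc
    have h₃ := hb v
    simp only [nbr2T, val_bind, val_op, List.length_cons]
    linarith

theorem nbr2T_time_le (A : AdjLists E) (u : U) (vs : List V) {b M : ℕ}
    (hb : ∀ v, (A.nbrV v).length ≤ b) : ∀ acc : List U, acc.length + vs.length * b ≤ M →
    (nbr2T A u vs acc).time ≤ vs.length * (b * (M + 2) + 2) + 1 := by
  induction vs with
  | nil => intro acc _; simp [nbr2T]
  | cons v vs ih =>
    intro acc hM
    rw [List.length_cons, add_mul, one_mul] at hM
    have h₁ := addNewT_length_le u (A.nbrV v) acc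
    have h₂ := ih (addNewT u (A.nbrV v) acc).val (by linarith [hb v])
    have h₃ := addNewT_time_le u (A.nbrV v) (M := M) acc (by linarith [hb v, Nat.zero_le (vs.length * b)])
    have h₄ := Nat.mul_le_mul_right (M + 2) (hb v)
    simp only [nbr2T, time_bind, time_op, val_op, List.length_cons]
    linarith

section Prepare

variable [Fintype V] [DecidableEq V]

theorem nbrU_length (A : AdjLists E) (u : U) : (A.nbrU u).length = (nbrs E u).card := by
  rw [← List.toFinset_card_of_nodup (A.nbrU_nodup u)]
  congr 1
  ext v
  simp [A.mem_nbrU]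

variable [Fintype U]

theorem nbrU_length_le (A : AdjLists E) (u : U) : (A.nbrU u).length ≤ bidegU E :=
  (nbrU_length A u).trans_le (card_nbrs_le E u)

theorem nbrV_length_le (A : AdjLists E) (v : V) : (A.nbrV v).length ≤ bidegU E := by
  rw [← List.toFinset_card_of_nodup (A.nbrV_nodup v)]
  refine le_trans (Finset.card_le_card fun u hu => ?_) (card_filter_mem_le E v)
  simpa [A.mem_nbrV] using hu

/-- The list `l` enumerates the vertices that share a neighbour with `u`. -/
def ListsSharing (E : Finset (U × V)) (u : U) (l : List U) : Prop :=
  l.Nodup ∧ ∀ w, w ∈ l ↔ w ∈ sharing E u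

theorem ListsSharing.length_eq {u : U} {l : List U} (h : ListsSharing E u l) :
    l.length = (sharing E u).card := by
  rw [← List.toFinset_card_of_nodup h.1]
  congr 1
  ext w
  rw [List.mem_toFinset, h.2]

theorem listsSharing_nbr2T (A : AdjLists E) (u : U) :
    ListsSharing E u (nbr2T A u (A.nbrU u) []).val := by
  refine ⟨nbr2T_nodup A u _ _ List.nodup_nil, fun w => ?_⟩
  simp [mem_nbr2T, mem_sharing, A.mem_nbrU]

/-- There are at most `b_U` neighbours `v`, each with at most `b_U` neighbours. -/
theorem card_sharing_le (A : AdjLists E) (u : U) : (sharing E u).card ≤ bidegU E ^ 2 := by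
  rw [← (listsSharing_nbr2T A u).length_eq, sq]
  have h₁ := nbr2T_length_le A u (A.nbrU u) (nbrV_length_le A) []
  have h₂ := Nat.mul_le_mul_right (bidegU E) (nbrU_length_le A u)
  rw [List.length_nil] at h₁
  omega

/-- The clause for `u ∉ us` carries the induction: later rounds do not overwrite what was stored for
an earlier vertex. The fourth power comes from up to `b_U²` membership tests per vertex in a list of
length up to `b_U²`. -/
theorem prepareT_spec (A : AdjLists E) (us : List U) :
    ∀ (n2 : U → List U) (cnt : U → ℕ) (mx : ℕ), us.Nodup →
      (∀ u ∈ us, ListsSharing E u ((prepareT A us n2 cnt mx).val.1 u) ∧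
        (prepareT A us n2 cnt mx).val.2.1 u = (projNbr E u \ ofU ∅).card ∧
        (prepareT A us n2 cnt mx).val.2.1 u ≤ (prepareT A us n2 cnt mx).val.2.2) ∧
      (∀ u ∉ us, (prepareT A us n2 cnt mx).val.1 u = n2 u ∧
        (prepareT A us n2 cnt mx).val.2.1 u = cnt u) ∧
      mx ≤ (prepareT A us n2 cnt mx).val.2.2 ∧
      (mx ≤ bidegU E ^ 2 + bidegU E →
        (prepareT A us n2 cnt mx).val.2.2 ≤ bidegU E ^ 2 + bidegU E) ∧
      (prepareT A us n2 cnt mx).time ≤ us.length * (20 * (bidegU E + 1) ^ 4) + 1 := by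
  induction us with
  | nil => intro n2 cnt mx _; simp [prepareT]
  | cons u us ih =>
    intro n2 cnt mx hus
    have hus' := List.nodup_cons.1 hus
    have hl := listsSharing_nbr2T A u
    have hlen := hl.length_eq
    have hnu := nbrU_length A u
    have hnu' := nbrU_length_le A u
    have hl2 := card_sharing_le A u
    have ht := nbr2T_time_le A u (A.nbrU u) (nbrV_length_le A) (M := bidegU E ^ 2) []
      (by rw [List.length_nil, zero_add, sq]; exact Nat.mul_le_mul_right _ hnu')
    simp only [prepareT, val_bind, time_bind, val_op, time_op, lengthT_val, lengthT_time]
    obtain ⟨h₁, h₂, h₃, h₄, h₅⟩ := ih (Function.update n2 u (nbr2T A u (A.nbrU u) []).val)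
      (Function.update cnt u ((A.nbrU u).length + (nbr2T A u (A.nbrU u) []).val.length))
      (max mx ((A.nbrU u).length + (nbr2T A u (A.nbrU u) []).val.length)) hus'.2
    refine ⟨fun w hw => ?_, fun w hw => ?_, (le_max_left _ _).trans h₃, fun hm => h₄ ?_, ?_⟩
    · rcases List.mem_cons.1 hw with rfl | hw
      · obtain ⟨e₁, e₂⟩ := h₂ w hus'.1
        rw [e₁, e₂, Function.update_self, Function.update_self]
        refine ⟨hl, ?_, (le_max_right _ _).trans h₃⟩
        rw [card_projNbr_sdiff, Finset.sdiff_empty, hlen, hnu, add_comm]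
      · exact h₁ w hw
    · obtain ⟨hwu, hw'⟩ := not_or.1 (mt List.mem_cons.2 hw)
      obtain ⟨e₁, e₂⟩ := h₂ w hw'
      rw [e₁, e₂, Function.update_of_ne hwu, Function.update_of_ne hwu]
      exact ⟨rfl, rfl⟩
    · exact max_le hm (by omega)
    · rw [List.length_cons]
      have h₆ := Nat.mul_le_mul_right (bidegU E * (bidegU E ^ 2 + 2) + 2) hnu'
      have h₇ : bidegU E * (bidegU E * (bidegU E ^ 2 + 2) + 2) + bidegU E + bidegU E ^ 2 + 8 ≤
          20 * (bidegU E + 1) ^ 4 := by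
        generalize bidegU E = b
        nlinarith [Nat.zero_le (b ^ 4), Nat.zero_le (b ^ 3), Nat.zero_le (b ^ 2)]
      linarith

end Prepare

/-- Deletion is lazy: a decremented vertex gets a new copy in its new bucket and the stale one
stays, so buckets only grow and no search inside a bucket is needed. -/
theorem decrT_spec (sel : U → Bool) (M : ℕ) (ws : List U) :
    ∀ (cnt : U → ℕ) (B : ℕ → List U), ws.Nodup →
      (∀ u, (decrT sel ws cnt B).val.1 u =
        if u ∈ ws ∧ sel u = false then cnt u - 1 else cnt u) ∧
      (∀ k, B k ⊆ (decrT sel ws cnt B).val.2 k) ∧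
      (∀ u ∈ ws, sel u = false → u ∈ (decrT sel ws cnt B).val.2 (cnt u - 1)) ∧
      bucketSize M (decrT sel ws cnt B).val.2 ≤ bucketSize M B + ws.length ∧
      (decrT sel ws cnt B).time ≤ 6 * ws.length + 1 := by
  induction ws with
  | nil => intro cnt B _; simp [decrT]
  | cons w ws ih =>
    intro cnt B hws
    have hws' := List.nodup_cons.1 hws
    rcases hs : sel w
    · simp only [decrT, val_bind, val_op, time_bind, time_op, hs, Bool.false_eq_true, if_false]
      obtain ⟨h₁, h₂, h₃, h₄, h₅⟩ := ih (Function.update cnt w (cnt w - 1))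
        (Function.update B (cnt w - 1) (w :: B (cnt w - 1))) hws'.2
      refine ⟨fun u => ?_, fun k => List.Subset.trans (subset_update_cons B _ w k) (h₂ k), fun u hu hsu => ?_,
        ?_, ?_⟩
      · rw [h₁]
        by_cases huw : u = w
        · subst huw; simp [hws'.1, hs]
        · simp [huw]
      · rcases List.mem_cons.1 hu with rfl | hu
        · exact h₂ _ (by simp)
        · have hne : u ≠ w := fun h => hws'.1 (h ▸ hu)
          simpa [hne] using h₃ u hu hsu
      · have := bucketSize_update_cons_le M (cnt w - 1) B w
        rw [List.length_cons]
        omega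
      · rw [List.length_cons]
        omega
    · simp only [decrT, val_bind, val_op, time_bind, time_op, hs, if_true]
      obtain ⟨h₁, h₂, h₃, h₄, h₅⟩ := ih cnt B hws'.2
      refine ⟨fun u => ?_, h₂, fun u hu hsu => ?_, ?_, ?_⟩
      · rw [h₁]
        by_cases huw : u = w
        · subst huw; simp [hs]
        · simp [huw]
      · rcases List.mem_cons.1 hu with rfl | hu
        · rw [hs] at hsu; exact absurd hsu (by simp)
        · exact h₃ u hu hsu
      · rw [List.length_cons]; omega
      · rw [List.length_cons]; omega

variable [Fintype U] [Fintype V] [DecidableEq V]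

/-- The selection phase, when the vertices of `prev` have been selected before. -/
theorem selectT_spec {n2 : U → List U} {mx L : ℕ} (hn2 : ∀ u, ListsSharing E u (n2 u))
    (hL : ∀ u, (n2 u).length ≤ L) (n : ℕ) :
    ∀ (prev : Finset U) (cnt : U → ℕ) (sel : U → Bool) (B : ℕ → List U),
      prev.card + n = Fintype.card U →
      (∀ u, sel u = false ↔ u ∉ prev) →
      (∀ u ∉ prev, cnt u = (projNbr E u \ ofU prev).card ∧ cnt u ≤ mx ∧ u ∈ B (cnt u)) →
      (selectT n2 mx n cnt sel B).val.Nodup ∧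
      (∀ u, u ∈ (selectT n2 mx n cnt sel B).val ↔ u ∉ prev) ∧
      OrderFrom E prev (selectT n2 mx n cnt sel B).val ∧
      (selectT n2 mx n cnt sel B).time ≤
        3 * bucketSize (mx + 1) B + n * (6 * (mx + 1) + 9 * L + 4) + 1 := by
  induction n with
  | zero =>
    intro prev cnt sel B hc _ _
    have : prev = Finset.univ := (Finset.card_eq_iff_eq_univ _).1 (by omega)
    subst this
    simp [selectT, OrderFrom]
  | succ n ih =>
    intro prev cnt sel B hc hsel hcnt
    have hex : ∃ u, u ∉ prev := by
      by_contra! h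
      have : prev.card = Fintype.card U :=
        (Finset.card_eq_iff_eq_univ _).2 (Finset.eq_univ_iff_forall.2 h)
      omega
    obtain ⟨u, B', h₁, h₂, h₃, h₄, h₅⟩ := findMinT_spec cnt sel (M := mx + 1) (mx + 1) 0 B
      (by omega) (fun u hu => ⟨(hcnt u ((hsel u).1 hu)).2.2, Nat.zero_le _⟩)
      (by
        obtain ⟨u, hu⟩ := hex
        exact ⟨u, (hsel u).2 hu, by have := (hcnt u hu).2.1; omega⟩)
    have hu := (hsel u).1 h₂
    obtain ⟨d₁, d₂, d₃, d₄, d₅⟩ := decrT_spec (Function.update sel u true) (mx + 1) (n2 u) cnt B'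
      (hn2 u).1
    have hsel' : ∀ w, Function.update sel u true w = false ↔ w ∉ insert u prev := fun w => by
      by_cases hw : w = u
      · subst hw; simp
      · simp [hw, hsel]
    obtain ⟨i₁, i₂, i₃, i₄⟩ := ih (insert u prev)
      (decrT (Function.update sel u true) (n2 u) cnt B').val.1 (Function.update sel u true)
      (decrT (Function.update sel u true) (n2 u) cnt B').val.2
      (by rw [Finset.card_insert_of_notMem hu]; omega) hsel' (fun w hw => by
        have hw' := (hsel' w).2 hw
        have hwp : w ∉ prev := fun h => hw (Finset.mem_insert_of_mem h)
        have hwu : w ≠ u := fun h => hw (h ▸ Finset.mem_insert_self _ _)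
        obtain ⟨c₁, c₂, c₃⟩ := hcnt w hwp
        rw [card_projNbr_sdiff_insert hu, d₁, ← c₁]
        simp only [← (hn2 u).2]
        by_cases hm : w ∈ n2 u
        · simp only [hm, hw', and_self, if_true, true_and]
          exact ⟨by omega, d₃ w hm hw'⟩
        · simp only [hm, false_and, if_false, true_and]
          exact ⟨c₂, d₂ _ (h₄ w ((hsel w).2 hwp) hwu)⟩)
    have hval : (selectT n2 mx (n + 1) cnt sel B).val = u :: (selectT n2 mx n
        (decrT (Function.update sel u true) (n2 u) cnt B').val.1 (Function.update sel u true)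
        (decrT (Function.update sel u true) (n2 u) cnt B').val.2).val := by
      simp only [selectT, val_bind, val_op, h₁]
    have htime : (selectT n2 mx (n + 1) cnt sel B).time = (findMinT cnt sel (mx + 1) 0 B).time +
        (decrT (Function.update sel u true) (n2 u) cnt B').time + (selectT n2 mx n
        (decrT (Function.update sel u true) (n2 u) cnt B').val.1 (Function.update sel u true)
        (decrT (Function.update sel u true) (n2 u) cnt B').val.2).time + 3 := by
      simp only [selectT, time_bind, val_op, time_op, h₁]
      ring
    rw [hval, htime]
    refine ⟨List.nodup_cons.2 ⟨fun h => (i₂ u).1 h (Finset.mem_insert_self _ _), i₁⟩,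
      fun w => ?_, ⟨fun w hw => ?_, i₃⟩, ?_⟩
    · rw [List.mem_cons, i₂, Finset.mem_insert]
      by_cases hw : w = u
      · subst hw; simpa using hu
      · simp [hw]
    · have hwp : w ∉ prev := by
        rcases List.mem_cons.1 hw with rfl | hw
        · exact hu
        · exact fun h => (i₂ w).1 hw (Finset.mem_insert_of_mem h)
      rw [← (hcnt u hu).1, ← (hcnt w hwp).1]
      exact h₃ w ((hsel w).2 hwp)
    -- Here `9 L = 6 L + 3 L`: six steps per vertex of `N₂(u)` for the decrements, and three to pay
    -- for the later purging of the copy just inserted.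
    · have := hL u
      linarith

/-- The computation of the bidegeneracy order. -/
theorem orderT_spec (A : AdjLists E) :
    IsBidegeneracyOrder E (orderT A).val.1 ∧ OrderFrom E ∅ (orderT A).val.1 ∧
      (∀ u, ListsSharing E u ((orderT A).val.2 u)) ∧
      (orderT A).time ≤ (Fintype.card U + 1) * (100 * (bidegU E + 1) ^ 4) := by
  have hlen : A.verts.length = Fintype.card U := by
    rw [← List.toFinset_card_of_nodup A.verts_nodup, ← Finset.card_univ]
    congr 1
    ext u
    simp [A.mem_verts]
  obtain ⟨p₁, -, -, p₄, p₅⟩ := prepareT_spec A A.verts (fun _ => []) (fun _ => 0) 0 A.verts_nodup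
  set s := prepareT A A.verts (fun _ => []) (fun _ => 0) 0 with hs
  obtain ⟨f₁, -, f₃, f₄⟩ := fillT_spec s.val.2.1 (s.val.2.2 + 1) A.verts (fun _ => [])
  have hL : ∀ u, (s.val.1 u).length ≤ bidegU E ^ 2 := fun u => by
    rw [(p₁ u (A.mem_verts u)).1.length_eq]
    exact card_sharing_le A u
  obtain ⟨s₁, s₂, s₃, s₄⟩ := selectT_spec (E := E) (mx := s.val.2.2)
    (fun u => (p₁ u (A.mem_verts u)).1) hL (Fintype.card U) ∅ s.val.2.1
    (fun _ => false) (fillT s.val.2.1 A.verts (fun _ => [])).val (by simp) (by simp)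
    (fun u _ => ⟨(p₁ u (A.mem_verts u)).2.1, (p₁ u (A.mem_verts u)).2.2,
      f₁ u (A.mem_verts u)⟩)
  have hval : (orderT A).val = ((selectT s.val.1 s.val.2.2 (Fintype.card U) s.val.2.1
      (fun _ => false) (fillT s.val.2.1 A.verts (fun _ => [])).val).val, s.val.1) := by
    simp only [orderT, val_bind, val_op, lengthT_val, alloc_val, hlen, hs]
  have htime : (orderT A).time = 4 * Fintype.card U + s.time + s.val.2.2 +
      (fillT s.val.2.1 A.verts (fun _ => [])).time + (selectT s.val.1 s.val.2.2 (Fintype.card U)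
      s.val.2.1 (fun _ => false) (fillT s.val.2.1 A.verts (fun _ => [])).val).time + 7 := by
    simp only [orderT, lengthT_val, alloc_val, hlen, time_bind, lengthT_time,
      alloc_time, time_op, hs]
    ring
  rw [hval, htime]
  refine ⟨⟨s₁, by simpa using s₂, fun prev rest u h w hw => ?_⟩, s₃,
    fun u => (p₁ u (A.mem_verts u)).1, ?_⟩
  · have h' := s₃
    dsimp only at h
    rw [h] at h'
    simpa using h'.minimal w hw
  · have hm := p₄ (Nat.zero_le _)
    have hb : bucketSize (s.val.2.2 + 1) (fun _ => ([] : List U)) = 0 := by simp [bucketSize]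
    rw [hb] at f₃
    rw [hlen] at f₃ f₄ p₅
    generalize bidegU E = b at *
    generalize Fintype.card U = ν at *
    have h₁ : ν * (6 * (s.val.2.2 + 1) + 9 * b ^ 2 + 4) ≤ ν * (6 * (b ^ 2 + b + 1) + 9 * b ^ 2 + 4) := by
      gcongr
    have h₂ : ν * (4 + 20 * (b + 1) ^ 4 + 3 + 3 + (6 * (b ^ 2 + b + 1) + 9 * b ^ 2 + 4)) ≤
        ν * (100 * (b + 1) ^ 4) := by
      refine Nat.mul_le_mul_left _ ?_
      nlinarith [Nat.zero_le (b ^ 4), Nat.zero_le (b ^ 3), Nat.zero_le (b ^ 2)]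
    have h₃ : b ^ 2 + b + 10 ≤ 100 * (b + 1) ^ 4 := by
      nlinarith [Nat.zero_le (b ^ 4), Nat.zero_le (b ^ 3), Nat.zero_le (b ^ 2)]
    linarith

end Order
/-! ### The branching recurrence -/

section Analysis

/-- Polynomials are compared with powers of `4 / 3` because this base is smaller than `3 ^ (1 / 3)`;
the strict gap is used in solving the recurrence. -/
theorem exists_pow_le (j : ℕ) :
    ∃ c : ℝ, 0 < c ∧ ∀ p : ℕ, ((p : ℝ) + 1) ^ j ≤ c * (4 / 3 : ℝ) ^ p := by
  obtain ⟨M, hM⟩ := (tendsto_pow_const_div_const_pow_of_one_lt j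
    (show (1 : ℝ) < 4 / 3 by norm_num)).bddAbove_range
  -- The boundedness is applied at `p + 1`, whence the factor `4 / 3`; the maximum with `1` makes
  -- the constant positive.
  refine ⟨(max M 1) * (4 / 3), by positivity, fun p => ?_⟩
  have h₁ : ((p + 1 : ℕ) : ℝ) ^ j / (4 / 3 : ℝ) ^ (p + 1) ≤ max M 1 :=
    (hM ⟨p + 1, rfl⟩).trans (le_max_left _ _)
  rw [div_le_iff₀ (by positivity)] at h₁
  push_cast at h₁
  rw [pow_succ] at h₁
  linarith

/-- The growth rate `3 ^ (1 / 3)`. -/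
noncomputable def growth : ℝ := (3 : ℝ) ^ (1 / 3 : ℝ)

theorem growth_pow_three : growth ^ 3 = 3 := by
  rw [growth, ← Real.rpow_natCast, ← Real.rpow_mul (by norm_num)]
  norm_num

theorem growth_pow (p : ℕ) : growth ^ p = (3 : ℝ) ^ ((p : ℝ) / 3) := by
  rw [growth, ← Real.rpow_natCast, ← Real.rpow_mul (by norm_num)]
  congr 1
  ring

theorem le_growth : 1.44 ≤ growth := by
  by_contra! h
  have h₀ : 0 ≤ growth := by unfold growth; positivity
  have := pow_lt_pow_left₀ h h₀ three_ne_zero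
  rw [growth_pow_three] at this
  norm_num at this

theorem growth_pos : 0 < growth := lt_of_lt_of_le (by norm_num) le_growth

theorem four_thirds_pow_le (p : ℕ) : (4 / 3 : ℝ) ^ p ≤ growth ^ p :=
  pow_le_pow_left₀ (by norm_num) (le_trans (by norm_num) le_growth) p

/-- Since `k = growth ^ k` at `k = 3`, that value must be excluded; elsewhere there is room for the
factor `29 / 30`, tightest at `k = 2`. From `4` on, one step multiplies the left side by at most `5
/ 4` and the right side by at least `1.44`. -/
theorem nat_le_growth_pow {k : ℕ} (hk : k ≠ 3) : (k : ℝ) ≤ 29 / 30 * growth ^ k := by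
  have hg := le_growth
  have h4 : ∀ k : ℕ, 4 ≤ k → (k : ℝ) ≤ 29 / 30 * growth ^ k := by
    intro k hk
    induction k, hk using Nat.le_induction with
    | base =>
      rw [pow_succ, growth_pow_three]
      push_cast
      linarith
    | succ k hk ih =>
      have hk' : (4 : ℝ) ≤ k := by exact_mod_cast hk
      have hp : 0 < growth ^ k := pow_pos growth_pos k
      rw [pow_succ]
      push_cast
      nlinarith
  rcases lt_or_ge k 4 with h | h
  · interval_cases k
    · norm_num
    · norm_num
      linarith
    · norm_num
      nlinarith
    · exact absurd rfl hk
  · exact h4 k h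

/-- A pure multiple of `growth ^ p` has no slack at `k = 3` to pay for the polynomial term.
Subtracting a multiple of the slower `(4 / 3) ^ p` creates it: tripling the subtracted term gains
more than the shift by `3` takes away, as `(4 / 3)³ < 3`. -/
theorem exists_isBranchBound :
    ∃ (F : ℕ → ℝ) (a : ℝ), IsBranchBound F ∧ 0 < a ∧ ∀ p, F p ≤ a * growth ^ p := by
  obtain ⟨c, hc, hpow⟩ := exists_pow_le 3
  have hg := le_growth
  refine ⟨fun p => c * (150 * growth ^ p - 4 * (4 / 3 : ℝ) ^ p), 150 * c, ⟨?_, ?_⟩, by positivity,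
    fun p => ?_⟩
  · refine monotone_nat_of_le_succ fun p => ?_
    have h₁ := four_thirds_pow_le p
    have h₂ : 0 < (4 / 3 : ℝ) ^ p := by positivity
    refine mul_le_mul_of_nonneg_left ?_ hc.le
    rw [pow_succ, pow_succ]
    nlinarith
  · intro p k hk
    obtain ⟨q, rfl⟩ := Nat.exists_eq_add_of_le hk
    rw [Nat.add_sub_cancel_left]
    refine (add_le_add_left (hpow (k + q)) _).trans ?_
    suffices (4 / 3 : ℝ) ^ (k + q) + k * (150 * growth ^ q - 4 * (4 / 3 : ℝ) ^ q) ≤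
        150 * growth ^ (k + q) - 4 * (4 / 3 : ℝ) ^ (k + q) by
      have := mul_le_mul_of_nonneg_left this hc.le
      linarith
    have hq : 0 < (4 / 3 : ℝ) ^ q := by positivity
    have hgq : 0 < growth ^ q := pow_pos growth_pos q
    by_cases h3 : k = 3
    -- The main terms cancel. The corrections leave `12 - 4 · 64/27 = 68/27` times `(4/3)^q`, and
    -- `64/27` is needed.
    · subst h3
      rw [pow_add, pow_add, growth_pow_three]
      norm_num
      linarith
    -- The main terms leave `150/30 = 5` times `growth ^ (k + q)`, which pays for the polynomial
    -- term and for the four subtracted powers of `4/3`.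
    · have h₁ := mul_le_mul_of_nonneg_right (nat_le_growth_pow h3) hgq.le
      have h₂ := four_thirds_pow_le (k + q)
      have h₃ : 0 ≤ (k : ℝ) * (4 / 3 : ℝ) ^ q := by positivity
      rw [mul_assoc, ← pow_add] at h₁
      linarith
  · have : 0 ≤ c * (4 / 3 : ℝ) ^ p := by positivity
    linarith

end Analysis

/-! ### The outer loop -/

section Main

variable {U V : Type} [DecidableEq U] [DecidableEq V] {E : Finset (U × V)}

theorem entriesT_val {α β : Type} [DecidableEq β] (nb : α → List β) (k : List β) (l : List α) :
    (entriesT nb k l).val = l.map fun x => (x, (nb x).filter (· ∈ k)) := by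
  simp [entriesT]

theorem entriesT_time_le {α β : Type} [DecidableEq β] {b c : ℕ} (nb : α → List β) (k : List β)
    (l : List α) (hnb : ∀ a, (nb a).length ≤ b) (hk : k.length ≤ c) :
    (entriesT nb k l).time ≤ l.length * (b * (c + 2) + 4) + 1 := by
  refine mapT_time_le _ _ _ fun a _ => ?_
  have h₁ := interT_time_le k (nb a)
  have h₂ : (nb a).length * (k.length + 2) ≤ b * (c + 2) := by gcongr; exact hnb a
  simp only [time_bind, time_op, val_op]
  omega

@[simp] theorem keys_entriesT {α β : Type} [DecidableEq β] (nb : α → List β) (k : List β)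
    (l : List α) : keys (entriesT nb k l).val = l := by
  simp [entriesT_val, keys, Function.comp_def]

theorem exact_entriesT {α β : Type} [DecidableEq β] {r : α → β → Prop} {nb : α → List β}
    (hn : ∀ a, (nb a).Nodup) (hr : ∀ a b, b ∈ nb a ↔ r a b) (k : List β) (l : List α) :
    Exact r k (entriesT nb k l).val := by
  intro e he
  rw [entriesT_val] at he
  obtain ⟨x, -, rfl⟩ := List.mem_map.1 he
  exact ⟨(hn x).filter _, fun b => by simp [hr, and_comm]⟩

/-- The sets with which the recursive function is called for `u`. -/
def startSets (A : AdjLists E) (u : U) (l : List U) (seen : U → Bool) : Sets U V :=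
  ⟨(entriesT A.nbrU (A.nbrU u) (l.filter fun w => !seen w)).val,
    (entriesT A.nbrV (l.filter fun w => !seen w) (A.nbrU u)).val,
    (entriesT A.nbrU (A.nbrU u) (l.filter fun w => seen w)).val, []⟩

theorem represents_startSets (A : AdjLists E) (u : U) {l : List U} (hl : l.Nodup)
    (seen : U → Bool) : RepresentsIn E (startSets A u l seen) := by
  have hU : ∀ u v, v ∈ A.nbrU u ↔ (u, v) ∈ E := A.mem_nbrU
  refine ⟨?_, ?_, ?_, ?_, ?_, ?_⟩
  · simp only [startSets, keys_entriesT]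
    refine List.nodup_append'.2 ⟨hl.filter _, hl.filter _, fun w h₁ h₂ => ?_⟩
    have h₁ := (List.mem_filter.1 h₁).2
    have h₂ := (List.mem_filter.1 h₂).2
    simp [h₂] at h₁
  · have h : keys (startSets A u l seen).pv = A.nbrU u := keys_entriesT _ _ _
    rw [h]
    simpa [startSets, keys] using A.nbrU_nodup u
  · simp only [startSets, keys_entriesT]
    exact exact_entriesT A.nbrU_nodup hU _ _
  · simp only [startSets, keys_entriesT]
    exact exact_entriesT A.nbrV_nodup (fun v u => A.mem_nbrV u v) _ _
  · simp only [startSets, keys_entriesT]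
    exact exact_entriesT A.nbrU_nodup hU _ _
  · simp [startSets, Exact]

variable [Fintype U] [Fintype V]

theorem pset_startSets (A : AdjLists E) {u : U} {l : List U} (hl : ListsSharing E u l)
    {seen : U → Bool} {prev : Finset U} (hs : ∀ w, seen w = true ↔ w ∈ prev) :
    (startSets A u l seen).pset = projNbr E u \ ofU prev := by
  have hs' : ∀ w, seen w = false ↔ w ∉ prev := fun w => by rw [← hs]; simp
  rw [projNbr_sdiff]
  ext (w | w)
  · simp [startSets, hl.2, hs']
  · simp [startSets, A.mem_nbrU]

theorem xset_startSets (A : AdjLists E) {u : U} {l : List U} (hl : ListsSharing E u l)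
    {seen : U → Bool} {prev : Finset U} (hs : ∀ w, seen w = true ↔ w ∈ prev) :
    (startSets A u l seen).xset = projNbr E u ∩ ofU prev := by
  rw [projNbr_inter]
  ext (w | w)
  · simp [startSets, hl.2, hs]
  · simp [startSets, keys]

/-- The number of sharing pairs `(u, w)` with `u` in the list `us` and `w` treated before `u`. -/
def backPairs (E : Finset (U × V)) : Finset U → List U → ℕ
  | _, [] => 0
  | prev, u :: us => (sharing E u ∩ prev).card + backPairs E (insert u prev) us

/-- The total of a top-level call is at most `b_U + 2 + |X|`, the `2` being `|R| = 1` and the added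
one. The sizes `|X|` are kept as the exact sum `backPairs`, because bounding each one separately by
`b_U²` would lose a factor `b_U`. -/
theorem outerT_spec {F : ℕ → ℝ} (hF : IsBranchBound F) (A : AdjLists E) {n2 : U → List U}
    (hn2 : ∀ u, ListsSharing E u (n2 u)) (us : List U) :
    ∀ (prev : Finset U) (seen : U → Bool) (out : List (List (U ⊕ V))),
      (∀ w, seen w = true ↔ w ∈ prev) → us.Nodup → (∀ u, u ∈ us ↔ u ∉ prev) →
      OrderFrom E prev us →
      Outer E prev us (out.map List.toFinset) ((outerT A n2 us seen out).val.map List.toFinset) ∧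
      ((outerT A n2 us seen out).time : ℝ) ≤
        us.length * (50 * ((bidegU E : ℝ) + 1) ^ 4) +
        34 * ((bidegU E + 2) * us.length + backPairs E prev us) * F (bidegU E) + 1 := by
  induction us with
  | nil =>
    intro prev seen out _ _ _ _
    exact ⟨Outer.nil _ _, by simp [outerT, backPairs]⟩
  | cons u us ih =>
    intro prev seen out hs hus hmem hord
    have hus' := List.nodup_cons.1 hus
    have hu : u ∉ prev := (hmem u).1 (by simp)
    have hrep := represents_startSets A u (hn2 u).1 seen
    have hP := pset_startSets A (hn2 u) hs
    have hX := xset_startSets A (hn2 u) hs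
    have hcp : (startSets A u (n2 u) seen).cardP ≤ bidegU E := by
      rw [← hrep.card_pset, hP]
      exact card_projNbr_sdiff_le hu fun w hw => hord.1 w ((hmem w).2 hw)
    have hcx : (startSets A u (n2 u) seen).cardX = (sharing E u ∩ prev).card := by
      rw [← hrep.card_xset, hX, projNbr_inter, Finset.card_disjSum, Finset.card_empty, add_zero]
    obtain ⟨c₁, t₁⟩ := callT_spec hF ((startSets A u (n2 u) seen).cardP + 1) [Sum.inl u]
      (startSets A u (n2 u) seen) out hrep (Nat.lt_succ_self _)
    obtain ⟨c₂, t₂⟩ := ih (insert u prev) (Function.update seen u true)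
      (callT ((startSets A u (n2 u) seen).cardP + 1) [Sum.inl u]
        (startSets A u (n2 u) seen) out).val
      (fun w => by
        by_cases hw : w = u
        · subst hw; simp
        · simp [hw, hs]) hus'.2
      (fun w => by
        have := hmem w
        rw [List.mem_cons] at this
        rw [Finset.mem_insert, not_or, ← this]
        exact ⟨fun h => ⟨fun h' => hus'.1 (h' ▸ h), .inr h⟩, fun h => h.2.resolve_left h.1⟩)
      hord.2
    have hval : (outerT A n2 (u :: us) seen out).val = (outerT A n2 us (Function.update seen u true)
        (callT ((startSets A u (n2 u) seen).cardP + 1) [Sum.inl u]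
          (startSets A u (n2 u) seen) out).val).val := by
      simp only [outerT, val_bind, val_op, lengthT_val, filterT_val, startSets, Sets.cardP]
    have htime : (outerT A n2 (u :: us) seen out).time ≤ 50 * (bidegU E + 1) ^ 4 +
        (callT ((startSets A u (n2 u) seen).cardP + 1) [Sum.inl u]
          (startSets A u (n2 u) seen) out).time +
        (outerT A n2 us (Function.update seen u true)
        (callT ((startSets A u (n2 u) seen).cardP + 1) [Sum.inl u]
          (startSets A u (n2 u) seen) out).val).time := by
      have hl : (n2 u).length ≤ bidegU E ^ 2 := by
        rw [(hn2 u).length_eq]; exact card_sharing_le A u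
      have hd := nbrU_length_le A u
      have hf : ∀ q : U → Bool, ((n2 u).filter q).length ≤ bidegU E ^ 2 := fun q =>
        (List.length_filter_le _ _).trans hl
      have h₁ := filterT_time_le (fun w => op (!seen w)) 1 (n2 u) fun _ _ => le_rfl
      have h₂ := filterT_time_le (fun w => op (seen w)) 1 (n2 u) fun _ _ => le_rfl
      have h₃ := entriesT_time_le A.nbrU (A.nbrU u) ((n2 u).filter fun w => !seen w)
        (nbrU_length_le A) hd
      have h₄ := entriesT_time_le A.nbrV ((n2 u).filter fun w => !seen w) (A.nbrU u)
        (nbrV_length_le A) (hf _)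
      have h₅ := entriesT_time_le A.nbrU (A.nbrU u) ((n2 u).filter fun w => seen w)
        (nbrU_length_le A) hd
      have h₆ := Nat.mul_le_mul_right (bidegU E * (bidegU E + 2) + 4) (hf fun w => !seen w)
      have h₇ := Nat.mul_le_mul_right (bidegU E * (bidegU E ^ 2 + 2) + 4) hd
      have h₈ := Nat.mul_le_mul_right (bidegU E * (bidegU E + 2) + 4) (hf fun w => seen w)
      have e₁ : (startSets A u (n2 u) seen).pu.length = ((n2 u).filter fun w => !seen w).length := by
        simp [startSets, entriesT_val]
      have e₂ : (startSets A u (n2 u) seen).pv.length = (A.nbrU u).length := by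
        simp [startSets, entriesT_val]
      have h₉ := hf fun w => !seen w
      have h₁₀ : 2 * (bidegU E ^ 2 * (bidegU E * (bidegU E + 2) + 4)) +
          bidegU E * (bidegU E * (bidegU E ^ 2 + 2) + 4) + 5 * bidegU E ^ 2 + bidegU E + 10 ≤
          50 * (bidegU E + 1) ^ 4 := by
        generalize bidegU E = b
        nlinarith [Nat.zero_le (b ^ 4), Nat.zero_le (b ^ 3), Nat.zero_le (b ^ 2)]
      have e : (outerT A n2 (u :: us) seen out).time = 3 +
          (filterT (fun w => op (!seen w)) (n2 u)).time +
          (filterT (fun w => op (seen w)) (n2 u)).time +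
          (entriesT A.nbrU (A.nbrU u) ((n2 u).filter fun w => !seen w)).time +
          (entriesT A.nbrV ((n2 u).filter fun w => !seen w) (A.nbrU u)).time +
          (entriesT A.nbrU (A.nbrU u) ((n2 u).filter fun w => seen w)).time +
          ((startSets A u (n2 u) seen).pu.length + 1) +
          ((startSets A u (n2 u) seen).pv.length + 1) +
          (callT ((startSets A u (n2 u) seen).cardP + 1) [Sum.inl u]
            (startSets A u (n2 u) seen) out).time +
          (outerT A n2 us (Function.update seen u true)
            (callT ((startSets A u (n2 u) seen).cardP + 1) [Sum.inl u]
            (startSets A u (n2 u) seen) out).val).time := by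
        simp only [outerT, val_op, lengthT_val, filterT_val, startSets, Sets.cardP, time_bind, time_op,
          lengthT_time]
        ring
      rw [e, e₁, e₂]
      linarith
    constructor
    · rw [hval]
      refine Outer.cons _ _ _ _ ((callT ((startSets A u (n2 u) seen).cardP + 1) [Sum.inl u]
        (startSets A u (n2 u) seen) out).val.map List.toFinset) _ ?_ c₂
      rw [← hP, ← hX]
      simpa using c₁
    · have htime' := (Nat.cast_le (α := ℝ)).2 htime
      have hFb : (0 : ℝ) ≤ F (bidegU E) := le_trans (by positivity) (hF.pow_le _)
      have htot : (total [(Sum.inl u : U ⊕ V)] (startSets A u (n2 u) seen) : ℝ) ≤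
          bidegU E + 2 + (sharing E u ∩ prev).card := by
        have : total [(Sum.inl u : U ⊕ V)] (startSets A u (n2 u) seen) ≤
            bidegU E + 2 + (sharing E u ∩ prev).card := by
          simp only [total, List.length_singleton, hcx]
          omega
        exact_mod_cast this
      have hmul : 34 * (total [(Sum.inl u : U ⊕ V)] (startSets A u (n2 u) seen) : ℝ) *
          F (startSets A u (n2 u) seen).cardP ≤
          34 * (bidegU E + 2 + (sharing E u ∩ prev).card) * F (bidegU E) := by
        have := hF.mono hcp
        have h₀ : (0 : ℝ) ≤ F (startSets A u (n2 u) seen).cardP :=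
          le_trans (by positivity) (hF.pow_le _)
        gcongr
      simp only [backPairs, List.length_cons]
      push_cast at htime' ⊢
      linarith

/-- Every sharing pair is counted backwards at most once, and forwards at its first vertex. -/
theorem backPairs_le (us : List U) : ∀ prev : Finset U, us.Nodup → (∀ u, u ∈ us ↔ u ∉ prev) →
    OrderFrom E prev us →
    backPairs E prev us ≤ ∑ w ∈ prev, (sharing E w \ prev).card + us.length * bidegU E := by
  induction us with
  | nil => intro prev _ _ _; simp [backPairs]
  | cons u us ih =>
    intro prev hus hmem hord
    have hus' := List.nodup_cons.1 hus
    have hu : u ∉ prev := (hmem u).1 (by simp)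
    have h := ih (insert u prev) hus'.2 (fun w => by
        have := hmem w
        rw [List.mem_cons] at this
        rw [Finset.mem_insert, not_or, ← this]
        exact ⟨fun h => ⟨fun h' => hus'.1 (h' ▸ h), .inr h⟩, fun h => h.2.resolve_left h.1⟩)
      hord.2
    have hub : (sharing E u \ prev).card ≤ bidegU E := by
      refine le_trans ?_ (card_projNbr_sdiff_le hu fun w hw => hord.1 w ((hmem w).2 hw))
      rw [card_projNbr_sdiff]
      exact Nat.le_add_right _ _
    have huu : (sharing E u \ insert u prev).card ≤ (sharing E u \ prev).card :=
      Finset.card_le_card (Finset.sdiff_subset_sdiff le_rfl (Finset.subset_insert _ _))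
    -- The potential counts sharing pairs with one end in `prev` and the other outside. Treating `u`
    -- uses up the pairs from `prev` to `u`, and by `hub` opens at most `b_U` new ones.
    have hsum : (sharing E u ∩ prev).card + ∑ w ∈ prev, (sharing E w \ insert u prev).card ≤
        ∑ w ∈ prev, (sharing E w \ prev).card := by
      have h₁ : (sharing E u ∩ prev).card = ∑ w ∈ prev, if u ∈ sharing E w then 1 else 0 := by
        rw [Finset.sum_boole, Nat.cast_id]
        congr 1
        ext w
        rw [Finset.mem_inter, Finset.mem_filter, mem_sharing_comm, and_comm]
      rw [h₁, ← Finset.sum_add_distrib]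
      refine Finset.sum_le_sum fun w hw => ?_
      rw [Finset.sdiff_insert]
      split_ifs with hm
      · rw [add_comm, Finset.card_erase_add_one (Finset.mem_sdiff.2 ⟨hm, hu⟩)]
      · rw [zero_add]
        exact Finset.card_le_card (Finset.erase_subset _ _)
    rw [Finset.sum_insert hu] at h
    rw [backPairs, List.length_cons, add_mul, one_mul]
    omega

end Main

end BBK

-- Assembly of the bound

theorem theorem2 :
    ∃ C : ℝ, ∀ (U V : Type) [Fintype U] [Fintype V] [DecidableEq U] [DecidableEq V]
      (E : Finset (U × V)), E.Nonempty → ∀ A : BBK.AdjLists E,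
        BBK.IsRun E ((BBK.bbkT A).val.map List.toFinset) ∧
        ((BBK.bbkT A).time : ℝ) ≤
          C * (((Fintype.card U : ℝ) + (E.card : ℝ)) * (BBK.bidegU E : ℝ) *
            (3 : ℝ) ^ ((BBK.bidegU E : ℝ) / 3)) := by
  obtain ⟨F, a, hF, ha, hFa⟩ := BBK.exists_isBranchBound
  obtain ⟨c, hc, hpow⟩ := BBK.exists_pow_le 4
  -- At the end `300 c` is needed for the polynomial part and `34 · 4 · a = 136 a` for the recursive
  -- calls.
  refine ⟨400 * c + 200 * a, ?_⟩
  intro U V _ _ _ _ E hE A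
  obtain ⟨o₁, o₂, o₃, o₄⟩ := BBK.orderT_spec A
  have hmem : ∀ u, u ∈ (BBK.orderT A).val.1 ↔ u ∉ (∅ : Finset U) := fun u => by
    simp [o₁.2.1 u]
  obtain ⟨c₁, t₁⟩ := BBK.outerT_spec hF A o₃ (BBK.orderT A).val.1 ∅ (fun _ => false) []
    (by simp) o₁.1 hmem o₂
  have hback := BBK.backPairs_le (BBK.orderT A).val.1 ∅ o₁.1 hmem o₂
  rw [Finset.sum_empty, zero_add] at hback
  have hlen : ∀ l : List U, l.Nodup → (∀ u, u ∈ l) → l.length = Fintype.card U := fun l hl h => by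
    rw [← List.toFinset_card_of_nodup hl, ← Finset.card_univ]
    congr 1
    ext u
    simp [h]
  have hus := hlen _ o₁.1 o₁.2.1
  have hverts := hlen _ A.verts_nodup A.mem_verts
  obtain ⟨⟨u, v⟩, huv⟩ := hE
  have hν : 1 ≤ Fintype.card U := Fintype.card_pos_iff.2 ⟨u⟩
  -- An edge forces `b_U ≥ 1`; otherwise the right-hand side would vanish and could not absorb the
  -- costs linear in `ν`.
  have hb : 1 ≤ BBK.bidegU E := by
    refine le_trans (Finset.card_pos.2 ⟨v, ?_⟩) (BBK.card_nbrs_le E u)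
    simpa using huv
  have hval : (BBK.bbkT A).val =
      (BBK.outerT A (BBK.orderT A).val.2 (BBK.orderT A).val.1 (fun _ => false) []).val := by
    simp only [BBK.bbkT, BBK.val_bind, BBK.alloc_val]
  have htime : (BBK.bbkT A).time = (BBK.orderT A).time + 2 * Fintype.card U + 2 +
      (BBK.outerT A (BBK.orderT A).val.2 (BBK.orderT A).val.1 (fun _ => false) []).time := by
    simp only [BBK.bbkT, BBK.time_bind, BBK.alloc_val, BBK.alloc_time, BBK.lengthT_val,
      BBK.lengthT_time, hverts]
    ring
  refine ⟨⟨(BBK.orderT A).val.1, o₁, ?_⟩, ?_⟩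
  · rw [hval]
    exact c₁
  rw [hus] at t₁ hback
  rw [htime, ← BBK.growth_pow]
  have o₄' := (Nat.cast_le (α := ℝ)).2 o₄
  have hback' := (Nat.cast_le (α := ℝ)).2 hback
  have hν' : (1 : ℝ) ≤ Fintype.card U := by exact_mod_cast hν
  have hb' : (1 : ℝ) ≤ BBK.bidegU E := by exact_mod_cast hb
  push_cast at o₄' hback' ⊢
  have hpb := (hpow (BBK.bidegU E)).trans
    (mul_le_mul_of_nonneg_left (BBK.four_thirds_pow_le (BBK.bidegU E)) hc.le)
  have hone : (1 : ℝ) ≤ ((BBK.bidegU E : ℝ) + 1) ^ 4 := one_le_pow₀ (by linarith)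
  have hFb := hFa (BBK.bidegU E)
  have hgp : 0 < BBK.growth ^ BBK.bidegU E := pow_pos BBK.growth_pos _
  have hm : (0 : ℝ) ≤ E.card := Nat.cast_nonneg _
  have hβ : (0 : ℝ) ≤ BBK.backPairs E ∅ (BBK.orderT A).val.1 := Nat.cast_nonneg _
  generalize (BBK.backPairs E ∅ (BBK.orderT A).val.1 : ℝ) = β at *
  generalize BBK.growth ^ BBK.bidegU E = g at *
  generalize F (BBK.bidegU E) = f at *
  generalize (BBK.bidegU E : ℝ) = b at *
  generalize (Fintype.card U : ℝ) = ν at *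
  generalize (E.card : ℝ) = m at *
  generalize hq : (b + 1) ^ 4 = q at *
  have hag : 0 < a * g := mul_pos ha hgp
  have hcg : 0 < c * g := mul_pos hc hgp
  have h₁ : 34 * ((b + 2) * ν + β) * f ≤ 34 * (4 * (ν * b)) * (a * g) := by
    -- This uses `β ≤ ν b` from the pair count and `2 ν ≤ 2 ν b`.
    have h₂ : (b + 2) * ν + β ≤ 4 * (ν * b) := by nlinarith
    have h₃ : 0 ≤ 4 * (ν * b) := by positivity
    calc 34 * ((b + 2) * ν + β) * f ≤ 34 * ((b + 2) * ν + β) * (a * g) := by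
          gcongr
      _ ≤ _ := by gcongr
  have h₂ : (ν + 1) * (100 * q) + 2 * ν + 2 + ν * (50 * q) + 1 ≤ 300 * (ν * q) := by
    nlinarith
  have h₃ : ν * q ≤ ν * b * (c * g) := by
    have : ν * q ≤ ν * (c * g) := by gcongr
    refine this.trans ?_
    gcongr
    nlinarith
  -- The bound already holds with `ν` in place of `ν + m`; the term with `m` only has to be
  -- nonnegative.
  have h₄ : 0 ≤ m * b * g * (400 * c + 200 * a) := by positivity
  have h₅ : 0 ≤ ν * b * (c * g) := by positivity
  have h₆ : 0 ≤ ν * b * (a * g) := by positivity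
  linarith
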